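/- Setting. Let $X$ be a measurable space and $\rho$ a probability measure on $X\times\mathbb R$ with marginal $\rho_X$ on $X$. Let $\mathcal H$ be a separable real reproducing kernel Hilbert space of functions on $X$ with measurable kernel $K$, $K_x=K(x,\cdot)$, and let $\mathcal E(f)=\int (f(x)-y)^2\,d\rho(x,y)$. Assumptions. (i) $f_{\mathcal H}\in\mathcal H$ satisfies $\mathcal E(f_{\mathcal H})=\min_{f\in\mathcal H}\mathcal E(f)<\infty$. (ii) The covariance operator $C$, $\langle f,Cg\rangle_{\mathcal H}=\int fg\,d\rho_X$, is well defined and bounded on $\mathcal H$, and with $\mathcal N_x(\lambda)=\langle K_x,(C+\lambda I)^{-1}K_x\rangle_{\mathcal H}$ one has, for all $\lambda>0$, $\sup_{x\in X}\mathcal N_x(\lambda)<\infty$ and $\int\mathcal N_x(\lambda)\,d\rho_X(x)\le Q\lambda^{-\gamma}$, where $Q>0$ and $0<\gamma\le1$. (iii) $s\ge0$, $1\le R<\infty$ and $\|C^{-s}f_{\mathcal H}\|_{\mathcal H}<R$, that is, $f_{\mathcal H}=C^sg$ for some $g\in\mathcal H$ with $\|g\|_{\mathcal H}<R$. Let $v=\min(s,1/2)$.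 Estimator. Let $n,m\ge1$, $x_1,\dots,x_n\in X$, $y\in\mathbb R^n$, $z_1,\dots,z_m\in\mathcal H$ and $\lambda>0$ be arbitrary. Put $B_{ij}=z_j(x_i)$, $G_{ij}=\langle z_i,z_j\rangle_{\mathcal H}$ and, with $\dagger$ the Moore–Penrose pseudoinverse, $$\hat f_{\lambda,m}=\sum_{i=1}^m\tilde\alpha_iz_i,\qquad \tilde\alpha=(B^\top B+\lambda nG)^\dagger B^\top y .$$ Let $Z_mf=(\langle z_i,f\rangle_{\mathcal H})_{i\le m}$, $P_m=Z_m^*(Z_mZ_m^*)^\dagger Z_m$, $S_nf=n^{-1/2}(f(x_i))_{i\le n}$, $\hat y=n^{-1/2}y$, and $\langle f,C_ng\rangle_{\mathcal H}=\frac1n\sum_{i=1}^nf(x_i)g(x_i)$. Theorem (error decomposition for KRLS + generalized Nyström). Under these assumptions $\mathcal E(\hat f_{\lambda,m})<\infty$ and $$\left|\mathcal E(\hat f_{\lambda,m})-\mathcal E(f_{\mathcal H})\right|^{1/2}\le q\left(\mathcal S(\lambda,n)+\mathcal C(m)^{1/2+v}+\lambda^{1/2+v}\right),$$ where $\mathcal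 S(\lambda,n)=\|(C+\lambda I)^{-1/2}(S_n^*\hat y-C_nf_{\mathcal H})\|_{\mathcal H}$, $\mathcal C(m)=\|(I-P_m)(C+\lambda I)^{1/2}\|^2$, $$q=R\,\max\left(1,\|C\|^{s-v}\right)\max\left(\beta^2,\,1+\theta\beta\right),$$ $\beta=\|(C_n+\lambda I)^{-1/2}(C+\lambda I)^{1/2}\|$ and $\theta=\|(C_n+\lambda I)^{1/2}(C+\lambda I)^{-1/2}\|$. In particular $q=R\max(\beta^2,1+\theta\beta)$ whenever $s\le1/2$ or $\|C\|\le1$. -/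

import Mathlib

open MeasureTheory
open scoped RealInnerProductSpace ENNReal

set_option linter.unusedSectionVars false

noncomputable section

namespace KRLS

/-! ### Linear algebra -/

/-- The four Penrose conditions: `B` is the Moore-Penrose pseudoinverse of the real matrix `A`. -/
structure IsMoorePenrose {k l : ℕ} (A : Matrix (Fin k) (Fin l) ℝ)
    (B : Matrix (Fin l) (Fin k) ℝ) : Prop where
  mul_mul_left : A * B * A = A
  mul_mul_right : B * A * B = B
  symm_left : (A * B).transpose = A * B
  symm_right : (B * A).transpose = B * A

open Classical in
/-- The Moore-Penrose pseudoinverse `A†`: the unique matrix with the Penrose conditions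
(it exists for every real matrix). -/
def pinv {k l : ℕ} (A : Matrix (Fin k) (Fin l) ℝ) : Matrix (Fin l) (Fin k) ℝ :=
  if h : ∃ B, IsMoorePenrose A B then h.choose else 0

section Hilbert

variable {H : Type*} [NormedAddCommGroup H] [InnerProductSpace ℝ H] [CompleteSpace H]

/-- `T = A ^ s` in the sense of the continuous functional calculus, for a positive bounded
operator `A` and `0 ≤ s`: whenever a real polynomial `p` is within `δ` of `t ↦ t ^ s` on
`[0, ‖A‖]` (which contains the spectrum of `A`), `p(A)` is within `δ` of `T` in operator norm.
By the Weierstrass theorem this determines `T`. -/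
def IsPosPow (A : H →L[ℝ] H) (s : ℝ) (T : H →L[ℝ] H) : Prop :=
  ∀ (p : Polynomial ℝ) (δ : ℝ), (∀ t ∈ Set.Icc (0 : ℝ) ‖A‖, |p.eval t - t ^ s| ≤ δ) →
    ‖Polynomial.aeval A p - T‖ ≤ δ

open Classical in
/-- The power `A ^ s` (`0 ≤ s`) of a positive bounded operator `A` on a real Hilbert space;
the power `A ^ (0 : ℝ)` is the identity, and `A ^ (1 / 2)` is the positive square root. -/
def posPow (A : H →L[ℝ] H) (s : ℝ) : H →L[ℝ] H :=
  if h : ∃ T, IsPosPow A s T then h.choose else 0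

/-- The regularized operator `A + λ I`. -/
def reg (A : H →L[ℝ] H) (lam : ℝ) : H →L[ℝ] H := A + lam • (1 : H →L[ℝ] H)

/-- `(A + λ I)^{1/2}`. -/
def regSqrt (A : H →L[ℝ] H) (lam : ℝ) : H →L[ℝ] H := posPow (reg A lam) (1 / 2)

/-- `(A + λ I)^{-1/2}`. -/
def regInvSqrt (A : H →L[ℝ] H) (lam : ℝ) : H →L[ℝ] H := Ring.inverse (regSqrt A lam)

/-- The operator `Z_m : H → ℝ^m`, `Z_m f = (⟪z_1, f⟫, …, ⟪z_m, f⟫)`; its adjoint is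
`Z_m^* a = ∑ i, a_i z_i`. -/
def anaOp {m : ℕ} (z : Fin m → H) : H →L[ℝ] EuclideanSpace ℝ (Fin m) :=
  (EuclideanSpace.equiv (Fin m) ℝ).symm.toContinuousLinearMap ∘L
    ContinuousLinearMap.pi fun i => innerSL ℝ (z i)

theorem anaOp_apply {m : ℕ} (z : Fin m → H) (f : H) (i : Fin m) : anaOp z f i = ⟪z i, f⟫ := rfl

theorem anaOp_adjoint_apply {m : ℕ} (z : Fin m → H) (a : EuclideanSpace ℝ (Fin m)) :
    (anaOp z).adjoint a = ∑ i, a i • z i := by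
  refine ext_inner_right ℝ fun f => ?_
  rw [ContinuousLinearMap.adjoint_inner_left, sum_inner]
  simp [PiLp.inner_apply, anaOp_apply, inner_smul_left, mul_comm]

/-- The Gram matrix `G_{mm} = Z_m Z_m^*`. -/
def gram {m : ℕ} (z : Fin m → H) : Matrix (Fin m) (Fin m) ℝ := .of fun i j => ⟪z i, z j⟫

/-- `P_m = Z_m^* (Z_m Z_m^*)† Z_m`. -/
def nysProj {m : ℕ} (z : Fin m → H) : H →L[ℝ] H :=
  (anaOp z).adjoint ∘L Matrix.toEuclideanCLM (𝕜 := ℝ) (pinv (gram z)) ∘L anaOp z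

end Hilbert

/-! ### The reproducing kernel Hilbert space -/

section Rkhs

variable {X : Type*} (H : Type*) [NormedAddCommGroup H] [InnerProductSpace ℝ H] [CompleteSpace H]
  [RKHS ℝ H X ℝ]

/-- The kernel section `K_x`, an element of `H`. -/
def kSec (x : X) : H := RKHS.kerFun H x (1 : ℝ)

/-- The reproducing kernel `K(x, x') = K_x(x')`. -/
def ker (x x' : X) : ℝ := kSec H x x'

variable {H}

theorem inner_kSec (f : H) (x : X) : ⟪f, kSec H x⟫ = f x := by
  simp [kSec]

/-- The expected risk `E(f) = ∫ (f(x) - y)² dρ(x, y)`, a value in `[0, ∞]`. -/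
def risk [MeasurableSpace X] (ρ : Measure (X × ℝ)) (f : H) : ℝ≥0∞ :=
  ∫⁻ p, ENNReal.ofReal ((f p.1 - p.2) ^ 2) ∂ρ

/-- `C` is the covariance operator of `μ`: a bounded operator on `H` with
`⟪f, C g⟫ = ∫ f g dμ`, the integrals being well defined. -/
def IsCovOp [MeasurableSpace X] (μ : Measure X) (C : H →L[ℝ] H) : Prop :=
  ∀ f g : H, Integrable (fun x => f x * g x) μ ∧ ⟪f, C g⟫ = ∫ x, f x * g x ∂μ

theorem IsCovOp.unique [MeasurableSpace X] {μ : Measure X} {C C' : H →L[ℝ] H}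
    (h : IsCovOp μ C) (h' : IsCovOp μ C') : C = C' := by
  ext1 g
  exact ext_inner_left ℝ fun f => by rw [(h f g).2, (h' f g).2]

variable (H) in
open Classical in
/-- The covariance operator of `μ` on `H`, for bounded covariance operators. -/
def covOp [MeasurableSpace X] (μ : Measure X) : H →L[ℝ] H :=
  if h : ∃ C : H →L[ℝ] H, IsCovOp μ C then h.choose else 0

theorem isCovOp_covOp [MeasurableSpace X] {μ : Measure X} (h : ∃ C : H →L[ℝ] H, IsCovOp μ C) :
    IsCovOp μ (covOp H μ) := by
  rw [covOp, dif_pos h]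
  exact h.choose_spec

variable (H) in
/-- `N_x(λ) = ⟪K_x, (C + λ I)⁻¹ K_x⟫`. -/
def effDimAt [MeasurableSpace X] (μ : Measure X) (lam : ℝ) (x : X) : ℝ :=
  ⟪kSec H x, Ring.inverse (reg (covOp H μ) lam) (kSec H x)⟫

variable (H) in
/-- Capacity assumption: `K` is measurable, `C` is (well defined and) bounded,
`N_∞(λ) = sup_x N_x(λ) < ∞` and `N(λ) = ∫ N_x(λ) dμ(x) ≤ Q λ^{-γ}` for all `λ > 0`. -/
structure CapacityAssumption [MeasurableSpace X] (μ : Measure X) (Q γ : ℝ) : Prop where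
  measurable_ker : Measurable fun p : X × X => ker H p.1 p.2
  bounded_cov : ∃ C : H →L[ℝ] H, IsCovOp μ C
  effDim_sup : ∀ lam : ℝ, 0 < lam → BddAbove (Set.range (effDimAt H μ lam))
  Q_pos : 0 < Q
  γ_pos : 0 < γ
  γ_le_one : γ ≤ 1
  effDim_le : ∀ lam : ℝ, 0 < lam → ∫ x, effDimAt H μ lam x ∂μ ≤ Q * lam ^ (-γ)

/-- Source assumption `‖C^{-s} f_H‖ < R`: `f_H` is in the range of `C^s` and has a preimage of
norm less than `R` (`C^{-s} f_H` is the preimage of least norm). -/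
def SourceAssumption [MeasurableSpace X] (μ : Measure X) (fH : H) (s R : ℝ) : Prop :=
  ∃ g : H, posPow (covOp H μ) s g = fH ∧ ‖g‖ < R

/-! ### Empirical operators and the estimator -/

variable (H) in
/-- The sampling operator `S_n f = n^{-1/2} (f(x_1), …, f(x_n))`. -/
def sampOp {n : ℕ} (x : Fin n → X) : H →L[ℝ] EuclideanSpace ℝ (Fin n) :=
  (Real.sqrt n)⁻¹ • anaOp fun i => kSec H (x i)

/-- The normalized outputs `ŷ = n^{-1/2} y`. -/
def yHat {n : ℕ} (y : Fin n → ℝ) : EuclideanSpace ℝ (Fin n) := (Real.sqrt n)⁻¹ • WithLp.toLp 2 y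

variable (H) in
/-- The empirical covariance operator `C_n = n⁻¹ ∑ i, K_{x_i} ⊗ K_{x_i}`. -/
def empCov {n : ℕ} (x : Fin n → X) : H →L[ℝ] H :=
  (n : ℝ)⁻¹ • ∑ i, InnerProductSpace.rankOne ℝ (kSec H (x i)) (kSec H (x i))

theorem inner_empCov {n : ℕ} (x : Fin n → X) (f g : H) :
    ⟪f, empCov H x g⟫ = (n : ℝ)⁻¹ * ∑ i, f (x i) * g (x i) := by
  simp only [empCov, smul_apply, sum_apply,
    InnerProductSpace.rankOne_apply, inner_smul_right, inner_sum, inner_kSec]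
  congr 1
  refine Finset.sum_congr rfl fun i _ => ?_
  rw [real_inner_comm, inner_kSec, mul_comm]

/-- The matrix `(B_{nm})_{ij} = z_j(x_i)`. -/
def evalMat {n m : ℕ} (x : Fin n → X) (z : Fin m → H) : Matrix (Fin n) (Fin m) ℝ :=
  .of fun i j => z j (x i)

/-- The coefficients `α̃ = (Bᵀ B + λ n G)† Bᵀ y` of the generalized Nyström estimator. -/
def nysCoef {n m : ℕ} (x : Fin n → X) (y : Fin n → ℝ) (z : Fin m → H) (lam : ℝ) : Fin m → ℝ :=
  (pinv ((evalMat x z).transpose * evalMat x z + (lam * n) • gram z)).mulVec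
    ((evalMat x z).transpose.mulVec y)

/-- The generalized Nyström estimator `f̂_{λ,m} = ∑ i, α̃_i z_i`. -/
def nysEstimator {n m : ℕ} (x : Fin n → X) (y : Fin n → ℝ) (z : Fin m → H) (lam : ℝ) : H :=
  ∑ i, nysCoef x y z lam i • z i

/-! ### The quantities in the error decomposition -/

/-- `S(λ, n) = ‖(C + λ I)^{-1/2} (S_n^* ŷ - C_n f_H)‖`. -/
def sampleErr [MeasurableSpace X] (μ : Measure X) (fH : H) {n : ℕ} (x : Fin n → X)
    (y : Fin n → ℝ) (lam : ℝ) : ℝ :=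
  ‖regInvSqrt (covOp H μ) lam ((sampOp H x).adjoint (yHat y) - empCov H x fH)‖

/-- `C(m) = ‖(I - P_m) (C + λ I)^{1/2}‖²`. -/
def compErr [MeasurableSpace X] (μ : Measure X) {m : ℕ} (z : Fin m → H) (lam : ℝ) : ℝ :=
  ‖(1 - nysProj z) ∘L regSqrt (covOp H μ) lam‖ ^ 2

variable (H) in
/-- `β = ‖(C_n + λ I)^{-1/2} (C + λ I)^{1/2}‖`. -/
def betaConst [MeasurableSpace X] (μ : Measure X) {n : ℕ} (x : Fin n → X) (lam : ℝ) : ℝ :=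
  ‖regInvSqrt (empCov H x) lam ∘L regSqrt (covOp H μ) lam‖

variable (H) in
/-- `θ = ‖(C_n + λ I)^{1/2} (C + λ I)^{-1/2}‖`. -/
def thetaConst [MeasurableSpace X] (μ : Measure X) {n : ℕ} (x : Fin n → X) (lam : ℝ) : ℝ :=
  ‖regSqrt (empCov H x) lam ∘L regInvSqrt (covOp H μ) lam‖

end Rkhs

end KRLS

end

noncomputable section

namespace KRLS

/-! ### Functional calculus of positive operators on a real Hilbert space -/

section FunctionalCalculus

open Polynomial

variable {H : Type*} [NormedAddCommGroup H] [InnerProductSpace ℝ H] [CompleteSpace H]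

/-! Write `W = (C + λ)^{1/2}`, `V = (C_n + λ)^{1/2}`, `P = P_m`. Minimality makes the residual of
`f_H` orthogonal to `H` in L², so the excess risk of `f` is `⟪f - f_H, C (f - f_H)⟫`, at most `‖W (f
- f_H)‖²` (`excess_risk`).

The estimator is `G w` with `w = S_n^* ŷ`, and two facts about `G` suffice: `V G V` is an orthogonal
projection, and `G (C_n + λ) P = P`. Split `G w - f_H = G (w - C_n f_H) - (1 - G (C_n + λ)) f_H - λ
G f_H`. Since `W G W = (W V⁻¹)(V G V)(V⁻¹ W)` has norm at most `β²`, the first term yields the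
sample error and the third the regularization bias. In the middle term `1 - G (C_n + λ)` annihilates
the range of `P`, so `1 - P` can be inserted twice: one copy meets `W`, the other the source power
`C^v` (`norm_regSqrt_apply_sub_le`).

Powers of `C` enter only through interpolation bounds for `v ≤ 1/2`, obtained from tangent lines of
the concave function `t ↦ t^{2v}`. The functional calculus behind them rests on `‖p(A)‖ ≤ sup |p|`
over `[0, ‖A‖]` (`norm_aeval_le`), proved over the reals by factoring polynomials and inverting
coercive operators. -/

theorem isUnit_of_forall_mul_sq_norm_le_inner {T : H →L[ℝ] H} {c : ℝ} (hc : 0 < c)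
    (h : ∀ x, c * ‖x‖ ^ 2 ≤ ⟪T x, x⟫) : IsUnit T := by
  refine ContinuousLinearMap.isUnit_of_forall_le_norm_inner_map T (c := ⟨c, hc.le⟩) hc fun x => ?_
  rw [mul_comm]
  exact (h x).trans (le_abs_self _)

/-- An affine function on `[0, ‖A‖]` is bounded below by its smaller endpoint value, and `⟪A x, x⟫`
lies between `0` and `‖A‖ ‖x‖²`; hence coercivity. -/
theorem isUnit_smul_add_smul_one {A : H →L[ℝ] H} (hA : A.IsPositive) {b c : ℝ}
    (h0 : 0 < c) (h1 : 0 < b * ‖A‖ + c) : IsUnit (b • A + c • (1 : H →L[ℝ] H)) := by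
  refine isUnit_of_forall_mul_sq_norm_le_inner (lt_min h0 h1) fun x => ?_
  have hpos : 0 ≤ ⟪A x, x⟫ := hA.inner_nonneg_left x
  have hle : ⟪A x, x⟫ ≤ ‖A‖ * ‖x‖ ^ 2 := by
    refine (real_inner_le_norm _ _).trans ?_
    rw [sq, ← mul_assoc]
    gcongr
    exact A.le_opNorm x
  have hx := sq_nonneg ‖x‖
  have e : ⟪(b • A + c • (1 : H →L[ℝ] H)) x, x⟫ = b * ⟪A x, x⟫ + c * ‖x‖ ^ 2 := by
    simp [inner_add_left, inner_smul_left]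
  rw [e]
  rcases le_total 0 b with hb | hb
  · have := mul_le_mul_of_nonneg_right (min_le_left c (b * ‖A‖ + c)) hx
    nlinarith [mul_nonneg hb hpos]
  · have := mul_le_mul_of_nonneg_right (min_le_right c (b * ‖A‖ + c)) hx
    nlinarith [mul_le_mul_of_nonpos_left hle hb]

/-- Completing the square: `4a (a A² + b A + c) = (2a A + b)² + (4ac - b²)` is coercive. -/
theorem isUnit_quadratic {A : H →L[ℝ] H} (hA : IsSelfAdjoint A) {a b c : ℝ}
    (h : discrim a b c < 0) : IsUnit (a • A ^ 2 + b • A + c • (1 : H →L[ℝ] H)) := by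
  rw [discrim] at h
  have ha : a ≠ 0 := by
    rintro rfl
    nlinarith [sq_nonneg b]
  have key : IsUnit ((4 * a) • (a • A ^ 2 + b • A + c • (1 : H →L[ℝ] H))) := by
    refine isUnit_of_forall_mul_sq_norm_le_inner (c := 4 * a * c - b ^ 2) (by linarith) fun x => ?_
    have e1 : ⟪(A ^ 2) x, x⟫ = ‖A x‖ ^ 2 := by
      rw [← real_inner_self_eq_norm_sq, pow_two, mul_apply_eq_comp]
      exact hA.isSymmetric (A x) x
    have e2 : ‖(2 * a) • A x + b • x‖ ^ 2
        = 4 * a ^ 2 * ‖A x‖ ^ 2 + 4 * a * b * ⟪A x, x⟫ + b ^ 2 * ‖x‖ ^ 2 := by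
      rw [norm_add_sq_real, norm_smul, norm_smul, inner_smul_left, inner_smul_right, mul_pow,
        mul_pow, Real.norm_eq_abs, Real.norm_eq_abs, sq_abs, sq_abs]
      simp
      ring
    have e3 : ⟪((4 * a) • (a • A ^ 2 + b • A + c • (1 : H →L[ℝ] H))) x, x⟫
        = 4 * a * (a * ‖A x‖ ^ 2 + b * ⟪A x, x⟫ + c * ‖x‖ ^ 2) := by
      rw [← e1]
      simp only [FunLike.coe_smul, FunLike.coe_add, Pi.smul_apply,
        Pi.add_apply, inner_smul_left, inner_add_left, one_apply_eq_self,
        real_inner_self_eq_norm_sq]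
      simp
    rw [e3]
    nlinarith [sq_nonneg ‖(2 * a) • A x + b • x‖]
  have h4 : (4 * a) ≠ 0 := by positivity
  have := key.smul (Units.mk0 (4 * a) h4)⁻¹
  rwa [Units.smul_def, smul_smul, Units.val_inv_eq_inv_val, Units.val_mk0, inv_mul_cancel₀ h4,
    one_smul] at this

theorem isUnit_aeval_of_irreducible {A : H →L[ℝ] H} (hA : A.IsPositive) {f : ℝ[X]}
    (hf : Irreducible f) (hroot : ∀ t ∈ Set.Icc (0 : ℝ) ‖A‖, f.eval t ≠ 0) :
    IsUnit (aeval A f) := by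
  obtain ⟨a, b, c, rfl⟩ : ∃ a b c, f = C a * X ^ 2 + C b * X + C c :=
    ⟨_, _, _, eq_quadratic_of_degree_le_two hf.degree_le_two⟩
  have e : aeval A (C a * X ^ 2 + C b * X + C c) = a • A ^ 2 + b • A + c • (1 : H →L[ℝ] H) := by
    simp [Algebra.algebraMap_eq_smul_one]
  rw [e]
  by_cases ha : a = 0
  · subst ha
    have hM := norm_nonneg A
    have hr : ∀ t ∈ Set.Icc (0 : ℝ) ‖A‖, b * t + c ≠ 0 := fun t ht => by
      simpa using hroot t ht
    -- Without a root on the interval, positivity at `0` propagates to `‖A‖`.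
    have hivt : ∀ b' c' : ℝ, (∀ t ∈ Set.Icc (0 : ℝ) ‖A‖, b' * t + c' ≠ 0) → 0 < c' →
        0 < b' * ‖A‖ + c' := by
      intro b' c' hr hc
      by_contra! hlt
      obtain ⟨t, ht, h0⟩ := intermediate_value_Icc' hM
        (f := fun t => b' * t + c') (by fun_prop)
        (show (0 : ℝ) ∈ Set.Icc (b' * ‖A‖ + c') (b' * 0 + c') from ⟨hlt, by simpa using hc.le⟩)
      exact hr t ht h0
    have hc0 : c ≠ 0 := by simpa using hr 0 ⟨le_rfl, hM⟩
    rw [zero_smul, zero_add]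
    rcases lt_or_gt_of_ne hc0 with hc | hc
    · have := isUnit_smul_add_smul_one hA (b := -b) (c := -c) (by linarith)
        (hivt _ _ (fun t ht h0 => hr t ht (by linarith)) (by linarith))
      rw [← IsUnit.neg_iff]
      convert this using 1
      rw [neg_smul, neg_smul, neg_add]
    · exact isUnit_smul_add_smul_one hA hc (hivt _ _ hr hc)
  · refine isUnit_quadratic hA.isSelfAdjoint ?_
    by_contra! hd
    obtain ⟨t, ht⟩ := exists_quadratic_eq_zero ha ⟨_, (Real.mul_self_sqrt hd).symm⟩
    have hdeg : (C a * X ^ 2 + C b * X + C c).degree = 2 := degree_quadratic ha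
    have := degree_eq_one_of_irreducible_of_root hf (x := t) (by
      rw [IsRoot.def]
      simp
      linarith)
    rw [hdeg] at this
    exact absurd this (by decide)

theorem isUnit_aeval {A : H →L[ℝ] H} (hA : A.IsPositive) (f : ℝ[X])
    (hroot : ∀ t ∈ Set.Icc (0 : ℝ) ‖A‖, f.eval t ≠ 0) : IsUnit (aeval A f) := by
  induction f using WfDvdMonoid.induction_on_irreducible with
  | zero => exact absurd eval_zero (hroot 0 ⟨le_rfl, norm_nonneg A⟩)
  | unit u hu => exact hu.map _
  | mul a i ha hi ih =>
    rw [map_mul]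
    refine (isUnit_aeval_of_irreducible hA hi fun t ht h => ?_).mul (ih fun t ht h => ?_)
    · exact hroot t ht (by rw [eval_mul, h, zero_mul])
    · exact hroot t ht (by rw [eval_mul, h, mul_zero])

/-- With `N = ‖T‖` and an inverse of norm `c`, the estimate `‖(N² - T²) x‖² ≤ N⁴‖x‖² - N²‖T x‖²`
would force `‖T x‖² ≤ (N² - 1/(c²N²)) ‖x‖²`, contradicting the value of the norm. -/
theorem not_isUnit_norm_sq_sub_sq {T : H →L[ℝ] H} (hT : IsSelfAdjoint T) (h0 : T ≠ 0) :
    ¬ IsUnit ((‖T‖ ^ 2) • (1 : H →L[ℝ] H) - T ^ 2) := by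
  intro hu
  obtain ⟨u, hu⟩ := hu
  set N := ‖T‖ with hN
  have hNpos : 0 < N := norm_pos_iff.mpr h0
  set c := ‖(↑u⁻¹ : H →L[ℝ] H)‖ with hc
  have h1 : ∀ x, ‖x‖ ≤ c * ‖(N ^ 2) • x - T (T x)‖ := fun x => by
    have : (↑u⁻¹ : H →L[ℝ] H) ((u : H →L[ℝ] H) x) = x := by
      rw [← mul_apply_eq_comp, Units.inv_mul, one_apply_eq_self]
    have h2 := (↑u⁻¹ : H →L[ℝ] H).le_opNorm ((u : H →L[ℝ] H) x)
    rw [this, hu] at h2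
    simpa [pow_two] using h2
  have h2 : ∀ x, ‖(N ^ 2) • x - T (T x)‖ ^ 2 ≤ N ^ 4 * ‖x‖ ^ 2 - N ^ 2 * ‖T x‖ ^ 2 := fun x => by
    have e : ⟪x, T (T x)⟫ = ‖T x‖ ^ 2 := by
      rw [← real_inner_self_eq_norm_sq]
      exact (hT.isSymmetric x (T x)).symm
    rw [norm_sub_sq_real, norm_smul, inner_smul_left, e]
    have h3 : ‖T (T x)‖ ^ 2 ≤ (N * ‖T x‖) ^ 2 := by
      gcongr
      exact T.le_opNorm _
    simp only [Real.norm_eq_abs, abs_pow, conj_trivial, abs_of_pos hNpos]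
    nlinarith
  have hcpos : 0 < c := by
    rw [hc, norm_pos_iff]
    intro h
    apply h0
    have : (1 : H →L[ℝ] H) = 0 := by rw [← Units.mul_inv u, h, mul_zero]
    rw [← mul_one T, this, mul_zero]
  have h3 : ∀ x, ‖T x‖ ^ 2 ≤ (N ^ 2 - (c ^ 2 * N ^ 2)⁻¹) * ‖x‖ ^ 2 := fun x => by
    have h4 : ‖x‖ ^ 2 ≤ c ^ 2 * (N ^ 4 * ‖x‖ ^ 2 - N ^ 2 * ‖T x‖ ^ 2) := by
      calc ‖x‖ ^ 2 ≤ (c * ‖(N ^ 2) • x - T (T x)‖) ^ 2 := by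
            gcongr
            exact h1 x
        _ = c ^ 2 * ‖(N ^ 2) • x - T (T x)‖ ^ 2 := by ring
        _ ≤ _ := by
            gcongr
            exact h2 x
    have hk : 0 < c ^ 2 * N ^ 2 := by positivity
    have : (c ^ 2 * N ^ 2) * ‖T x‖ ^ 2
        ≤ (c ^ 2 * N ^ 2) * ((N ^ 2 - (c ^ 2 * N ^ 2)⁻¹) * ‖x‖ ^ 2) := by
      have e : (c ^ 2 * N ^ 2) * ((N ^ 2 - (c ^ 2 * N ^ 2)⁻¹) * ‖x‖ ^ 2)
          = c ^ 2 * N ^ 4 * ‖x‖ ^ 2 - ‖x‖ ^ 2 := by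
        field_simp
      rw [e]
      linarith
    exact le_of_mul_le_mul_left this hk
  set M := N ^ 2 - (c ^ 2 * N ^ 2)⁻¹ with hM
  have hlt : M < N ^ 2 := by
    rw [hM]
    have : 0 < (c ^ 2 * N ^ 2)⁻¹ := by positivity
    linarith
  have h5 : N ≤ Real.sqrt M := by
    refine T.opNorm_le_bound (Real.sqrt_nonneg _) fun x => ?_
    rw [← Real.sqrt_sq (norm_nonneg (T x)), ← Real.sqrt_sq (norm_nonneg x), ← Real.sqrt_mul' _ (sq_nonneg _)]
    exact Real.sqrt_le_sqrt (h3 x)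
  have h6 : Real.sqrt M < N := by
    rw [Real.sqrt_lt' hNpos]
    exact hlt
  linarith

theorem isSelfAdjoint_aeval {A : H →L[ℝ] H} (hA : IsSelfAdjoint A) (p : ℝ[X]) :
    IsSelfAdjoint (aeval A p) := by
  induction p using Polynomial.induction_on' with
  | add p q hp hq => rw [map_add]; exact hp.add hq
  | monomial n a =>
    rw [aeval_monomial, Algebra.algebraMap_eq_smul_one, smul_one_mul]
    exact (IsSelfAdjoint.all a).smul (hA.pow n)

/-- If `‖p(A)‖ > K`, then `‖p(A)‖² - p²` has no root on `[0, ‖A‖]`, so `‖p(A)‖² - p(A)²` is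
invertible, which a nonzero self-adjoint operator forbids. -/
theorem norm_aeval_le {A : H →L[ℝ] H} (hA : A.IsPositive) (p : ℝ[X]) {K : ℝ}
    (hK : ∀ t ∈ Set.Icc (0 : ℝ) ‖A‖, |p.eval t| ≤ K) : ‖aeval A p‖ ≤ K := by
  by_contra! hlt
  have hK0 : 0 ≤ K := (abs_nonneg _).trans (hK 0 ⟨le_rfl, norm_nonneg A⟩)
  refine not_isUnit_norm_sq_sub_sq (isSelfAdjoint_aeval hA.isSelfAdjoint p)
    (norm_pos_iff.mp (hK0.trans_lt hlt)) ?_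
  have := isUnit_aeval hA (C (‖aeval A p‖ ^ 2) - p ^ 2) fun t ht h => ?_
  · simpa [Algebra.algebraMap_eq_smul_one, _root_.smul_pow] using this
  · have h1 := hK t ht
    have h2 : |p.eval t| ^ 2 ≤ K ^ 2 := by gcongr
    have h3 : K ^ 2 < ‖aeval A p‖ ^ 2 := by gcongr
    simp only [eval_sub, eval_C, eval_pow] at h
    rw [sq_abs] at h2
    linarith

/-- `T = f(A)` in the sense of the continuous functional calculus of a positive operator. -/
def IsFunCalc (A : H →L[ℝ] H) (f : ℝ → ℝ) (T : H →L[ℝ] H) : Prop :=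
  ∀ (p : ℝ[X]) (δ : ℝ), (∀ t ∈ Set.Icc (0 : ℝ) ‖A‖, |p.eval t - f t| ≤ δ) →
    ‖aeval A p - T‖ ≤ δ

/-- One good polynomial per `ε` suffices: `norm_aeval_le` compares every other approximant with it.
-/
theorem isFunCalc_of_approx {A : H →L[ℝ] H} (hA : A.IsPositive) {f : ℝ → ℝ} {T : H →L[ℝ] H}
    (h : ∀ ε > 0, ∃ p : ℝ[X], (∀ t ∈ Set.Icc (0 : ℝ) ‖A‖, |p.eval t - f t| ≤ ε) ∧
      ‖aeval A p - T‖ ≤ ε) : IsFunCalc A f T := by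
  intro q δ hq
  refine le_of_forall_pos_le_add fun ε hε => ?_
  obtain ⟨p, hp, hpT⟩ := h (ε / 2) (half_pos hε)
  have h1 : ‖aeval A (q - p)‖ ≤ δ + ε / 2 := norm_aeval_le hA _ fun t ht => by
    rw [eval_sub, show q.eval t - p.eval t = (q.eval t - f t) - (p.eval t - f t) by ring]
    exact (abs_sub _ _).trans (add_le_add (hq t ht) (hp t ht))
  calc ‖aeval A q - T‖ = ‖aeval A (q - p) + (aeval A p - T)‖ := by rw [map_sub]; congr 1; abel
    _ ≤ _ := norm_add_le _ _
    _ ≤ (δ + ε / 2) + ε / 2 := add_le_add h1 hpT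
    _ = δ + ε := by ring

theorem IsFunCalc.approx {A : H →L[ℝ] H} {f : ℝ → ℝ} {T : H →L[ℝ] H} (h : IsFunCalc A f T)
    (hf : ContinuousOn f (Set.Icc 0 ‖A‖)) {ε : ℝ} (hε : 0 < ε) :
    ∃ p : ℝ[X], (∀ t ∈ Set.Icc (0 : ℝ) ‖A‖, |p.eval t - f t| ≤ ε) ∧ ‖aeval A p - T‖ ≤ ε := by
  obtain ⟨p, hp⟩ := exists_polynomial_near_of_continuousOn 0 ‖A‖ f hf ε hε
  exact ⟨p, fun t ht => (hp t ht).le, h p ε fun t ht => (hp t ht).le⟩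

theorem exists_isFunCalc {A : H →L[ℝ] H} (hA : A.IsPositive) {f : ℝ → ℝ}
    (hf : ContinuousOn f (Set.Icc 0 ‖A‖)) : ∃ T, IsFunCalc A f T := by
  have hpos : ∀ k : ℕ, (0 : ℝ) < 1 / (k + 1) := fun k => by positivity
  choose p hp using fun k : ℕ =>
    exists_polynomial_near_of_continuousOn 0 ‖A‖ f hf (1 / (k + 1)) (hpos k)
  have hd : ∀ k l, ‖aeval A (p k) - aeval A (p l)‖ ≤ 1 / (k + 1) + 1 / (l + 1) := fun k l => by
    rw [← map_sub]
    refine norm_aeval_le hA _ fun t ht => ?_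
    rw [eval_sub, show (p k).eval t - (p l).eval t
      = ((p k).eval t - f t) - ((p l).eval t - f t) by ring]
    exact (abs_sub _ _).trans (add_le_add (hp k t ht).le (hp l t ht).le)
  have hlim : Filter.Tendsto (fun k : ℕ => (1 : ℝ) / (k + 1)) Filter.atTop (nhds 0) :=
    tendsto_one_div_add_atTop_nhds_zero_nat
  have hc : CauchySeq fun k => aeval A (p k) := by
    refine cauchySeq_of_le_tendsto_0 (fun N : ℕ => (1 : ℝ) / (N + 1) + 1 / (N + 1))
      (fun k l N hk hl => ?_) (by simpa using hlim.add hlim)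
    rw [dist_eq_norm]
    refine (hd k l).trans ?_
    gcongr
  obtain ⟨T, hT⟩ := cauchySeq_tendsto_of_complete hc
  refine ⟨T, isFunCalc_of_approx hA fun ε hε => ?_⟩
  have h1 := (tendsto_iff_norm_sub_tendsto_zero.mp hT).eventually (gt_mem_nhds hε)
  obtain ⟨k, hk1, hk2⟩ := (h1.and (hlim.eventually (gt_mem_nhds hε))).exists
  exact ⟨p k, fun t ht => ((hp k t ht).trans hk2).le, hk1.le⟩

theorem IsFunCalc.unique {A : H →L[ℝ] H} {f : ℝ → ℝ} {T U : H →L[ℝ] H}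
    (hT : IsFunCalc A f T) (hU : IsFunCalc A f U) (hf : ContinuousOn f (Set.Icc 0 ‖A‖)) :
    T = U := by
  rw [← sub_eq_zero, ← norm_le_zero_iff]
  refine le_of_forall_pos_le_add fun ε hε => ?_
  obtain ⟨p, hp, hpT⟩ := hT.approx hf (half_pos hε)
  have hpU := hU p _ hp
  calc ‖T - U‖ = ‖(aeval A p - U) - (aeval A p - T)‖ := by congr 1; abel
    _ ≤ _ := norm_sub_le _ _
    _ ≤ ε / 2 + ε / 2 := add_le_add hpU hpT
    _ = 0 + ε := by ring

theorem IsFunCalc.congr {A : H →L[ℝ] H} {f g : ℝ → ℝ} {T : H →L[ℝ] H} (hT : IsFunCalc A f T)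
    (h : ∀ t ∈ Set.Icc (0 : ℝ) ‖A‖, f t = g t) : IsFunCalc A g T := fun p δ hp =>
  hT p δ fun t ht => by rw [h t ht]; exact hp t ht

theorem isFunCalc_id {A : H →L[ℝ] H} (hA : A.IsPositive) : IsFunCalc A (fun t => t) A :=
  isFunCalc_of_approx hA fun ε hε => ⟨X, fun t _ => by simpa using hε.le, by simpa using hε.le⟩

theorem IsFunCalc.norm_le {A : H →L[ℝ] H} {f : ℝ → ℝ} {T : H →L[ℝ] H} (hT : IsFunCalc A f T)
    {K : ℝ} (hK : ∀ t ∈ Set.Icc (0 : ℝ) ‖A‖, |f t| ≤ K) : ‖T‖ ≤ K := by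
  simpa using hT 0 K fun t ht => by simpa using hK t ht

theorem IsFunCalc.isSelfAdjoint {A : H →L[ℝ] H} (hA : A.IsPositive) {f : ℝ → ℝ}
    {T : H →L[ℝ] H} (hT : IsFunCalc A f T) (hf : ContinuousOn f (Set.Icc 0 ‖A‖)) :
    IsSelfAdjoint T := by
  refine IsFunCalc.unique (f := f) (A := A) (isFunCalc_of_approx hA fun ε hε => ?_) hT hf
  obtain ⟨p, hp, hpT⟩ := hT.approx hf hε
  refine ⟨p, hp, ?_⟩
  rwa [← (isSelfAdjoint_aeval hA.isSelfAdjoint p).star_eq, ← star_sub, norm_star]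

theorem IsFunCalc.mul {A : H →L[ℝ] H} (hA : A.IsPositive) {f g : ℝ → ℝ} {T U : H →L[ℝ] H}
    (hT : IsFunCalc A f T) (hU : IsFunCalc A g U) (hf : ContinuousOn f (Set.Icc 0 ‖A‖))
    (hg : ContinuousOn g (Set.Icc 0 ‖A‖)) : IsFunCalc A (fun t => f t * g t) (T * U) := by
  obtain ⟨K, hK⟩ := isCompact_Icc.exists_bound_of_continuousOn hf
  obtain ⟨L, hL⟩ := isCompact_Icc.exists_bound_of_continuousOn hg
  have hK0 : 0 ≤ K := (norm_nonneg _).trans (hK 0 ⟨le_rfl, norm_nonneg A⟩)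
  have hL0 : 0 ≤ L := (norm_nonneg _).trans (hL 0 ⟨le_rfl, norm_nonneg A⟩)
  refine isFunCalc_of_approx hA fun ε hε => ?_
  -- `η ≤ 1` lets `K + 1` bound the approximant of `f`; the last condition is the product-rule
  -- error.
  obtain ⟨η, hη, hη1, hηε⟩ : ∃ η : ℝ, 0 < η ∧ η ≤ 1 ∧ (K + 1) * η + η * L ≤ ε := by
    refine ⟨min 1 (ε / (K + 1 + L)), by positivity, min_le_left _ _, ?_⟩
    calc (K + 1) * min 1 (ε / (K + 1 + L)) + min 1 (ε / (K + 1 + L)) * L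
        = (K + 1 + L) * min 1 (ε / (K + 1 + L)) := by ring
      _ ≤ (K + 1 + L) * (ε / (K + 1 + L)) := by gcongr; exact min_le_right _ _
      _ = ε := by field_simp
  obtain ⟨p, hp, hpT⟩ := hT.approx hf hη
  obtain ⟨q, hq, hqU⟩ := hU.approx hg hη
  refine ⟨p * q, fun t ht => ?_, ?_⟩
  · have hpt := hp t ht
    have hpK : |p.eval t| ≤ K + 1 := by
      calc |p.eval t| = |f t + (p.eval t - f t)| := by ring_nf
        _ ≤ |f t| + |p.eval t - f t| := abs_add_le _ _
        _ ≤ K + 1 := add_le_add (hK t ht) (hpt.trans hη1)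
    calc |(p * q).eval t - f t * g t|
        = |p.eval t * (q.eval t - g t) + (p.eval t - f t) * g t| := by rw [eval_mul]; ring_nf
      _ ≤ |p.eval t| * |q.eval t - g t| + |p.eval t - f t| * |g t| := by
          rw [← abs_mul, ← abs_mul]; exact abs_add_le _ _
      _ ≤ (K + 1) * η + η * L := by
          gcongr
          · exact hq t ht
          · exact hL t ht
      _ ≤ ε := hηε
  · have hU' : ‖U‖ ≤ L := hU.norm_le hL
    have hpK : ‖aeval A p‖ ≤ K + 1 := by
      calc ‖aeval A p‖ = ‖T + (aeval A p - T)‖ := by congr 1; abel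
        _ ≤ ‖T‖ + ‖aeval A p - T‖ := norm_add_le _ _
        _ ≤ K + 1 := add_le_add (hT.norm_le hK) (hpT.trans hη1)
    calc ‖aeval A (p * q) - T * U‖
        = ‖aeval A p * (aeval A q - U) + (aeval A p - T) * U‖ := by
          rw [map_mul]; congr 1; noncomm_ring
      _ ≤ ‖aeval A p‖ * ‖aeval A q - U‖ + ‖aeval A p - T‖ * ‖U‖ :=
          (norm_add_le _ _).trans (add_le_add (norm_mul_le _ _) (norm_mul_le _ _))
      _ ≤ (K + 1) * η + η * L := by gcongr
      _ ≤ ε := hηε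

/-- Positivity follows from the norm bound: `0 ≤ p ≤ K` gives `‖K - p(A)‖ ≤ K`. -/
theorem inner_aeval_nonneg {A : H →L[ℝ] H} (hA : A.IsPositive) (p : ℝ[X])
    (hp : ∀ t ∈ Set.Icc (0 : ℝ) ‖A‖, 0 ≤ p.eval t) (u : H) : 0 ≤ ⟪u, aeval A p u⟫ := by
  obtain ⟨K, hK⟩ := isCompact_Icc.exists_bound_of_continuousOn
    (p.continuous.continuousOn (s := Set.Icc (0 : ℝ) ‖A‖))
  have h1 : ‖aeval A (C K - p)‖ ≤ K := norm_aeval_le hA _ fun t ht => by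
    have h2 := (abs_le.mp (hK t ht)).2
    rw [eval_sub, eval_C, abs_of_nonneg (by linarith)]
    linarith [hp t ht]
  have h2 : ⟪u, aeval A (C K - p) u⟫ ≤ K * ‖u‖ ^ 2 := by
    refine (real_inner_le_norm _ _).trans ?_
    calc ‖u‖ * ‖aeval A (C K - p) u‖ ≤ ‖u‖ * (K * ‖u‖) := by
          gcongr
          exact ContinuousLinearMap.le_of_opNorm_le _ h1 u
      _ = _ := by ring
  rw [map_sub, aeval_C, Algebra.algebraMap_eq_smul_one, sub_apply,
    inner_sub_right, smul_apply, one_apply_eq_self, inner_smul_right,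
    real_inner_self_eq_norm_sq] at h2
  linarith

theorem IsFunCalc.inner_le {A : H →L[ℝ] H} (hA : A.IsPositive) {f : ℝ → ℝ} {T : H →L[ℝ] H}
    (hT : IsFunCalc A f T) (hf : ContinuousOn f (Set.Icc 0 ‖A‖)) {a b : ℝ}
    (h : ∀ t ∈ Set.Icc (0 : ℝ) ‖A‖, f t ≤ a * t + b) (u : H) :
    ⟪u, T u⟫ ≤ a * ⟪u, A u⟫ + b * ‖u‖ ^ 2 := by
  -- One `ε` comes from replacing `f` by a polynomial, the other from replacing `T`.
  have key : ∀ ε > 0, ⟪u, T u⟫ ≤ a * ⟪u, A u⟫ + b * ‖u‖ ^ 2 + 2 * ε * ‖u‖ ^ 2 := by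
    intro ε hε
    obtain ⟨p, hp, hpT⟩ := hT.approx hf hε
    have h1 := inner_aeval_nonneg hA (C a * X + C (b + ε) - p) (fun t ht => by
      have := (abs_le.mp (hp t ht)).2
      simp only [eval_sub, eval_add, eval_mul, eval_C, eval_X]
      linarith [h t ht]) u
    have e : aeval A (C a * X + C (b + ε) - p) u = a • A u + (b + ε) • u - aeval A p u := by
      rw [map_sub, map_add, map_mul, aeval_C, aeval_C, aeval_X]
      simp only [Algebra.algebraMap_eq_smul_one, smul_one_mul]
      rfl
    rw [e, inner_sub_right, inner_add_right, inner_smul_right, inner_smul_right,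
      real_inner_self_eq_norm_sq] at h1
    have h2 : -⟪u, (aeval A p - T) u⟫ ≤ ε * ‖u‖ ^ 2 := by
      refine (neg_le_abs _).trans ((abs_real_inner_le_norm _ _).trans ?_)
      calc ‖u‖ * ‖(aeval A p - T) u‖ ≤ ‖u‖ * (ε * ‖u‖) := by
            gcongr
            exact ContinuousLinearMap.le_of_opNorm_le _ hpT u
        _ = _ := by ring
    rw [sub_apply, inner_sub_right] at h2
    linarith
  by_cases hu : ‖u‖ = 0
  · simpa [hu] using key 1 one_pos
  · refine le_of_forall_pos_le_add fun ε hε => ?_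
    have hu2 : 0 < ‖u‖ ^ 2 := by positivity
    have := key (ε / (2 * ‖u‖ ^ 2)) (by positivity)
    rwa [show 2 * (ε / (2 * ‖u‖ ^ 2)) * ‖u‖ ^ 2 = ε by field_simp] at this

/-! ### Powers and regularized square roots -/

theorem continuousOn_rpow {s : ℝ} (hs : 0 ≤ s) (S : Set ℝ) :
    ContinuousOn (fun t : ℝ => t ^ s) S :=
  (Real.continuous_rpow_const hs).continuousOn

theorem isFunCalc_posPow {A : H →L[ℝ] H} (hA : A.IsPositive) {s : ℝ} (hs : 0 ≤ s) :
    IsFunCalc A (fun t => t ^ s) (posPow A s) := by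
  have h : ∃ T, IsPosPow A s T := exists_isFunCalc hA (continuousOn_rpow hs _)
  rw [posPow, dif_pos h]
  exact h.choose_spec

theorem isSelfAdjoint_posPow {A : H →L[ℝ] H} (hA : A.IsPositive) {s : ℝ} (hs : 0 ≤ s) :
    IsSelfAdjoint (posPow A s) :=
  (isFunCalc_posPow hA hs).isSelfAdjoint hA (continuousOn_rpow hs _)

theorem posPow_add {A : H →L[ℝ] H} (hA : A.IsPositive) {s r : ℝ} (hs : 0 ≤ s) (hr : 0 ≤ r) :
    posPow A (s + r) = posPow A s * posPow A r := by
  refine (isFunCalc_posPow hA (add_nonneg hs hr)).unique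
    (((isFunCalc_posPow hA hs).mul hA (isFunCalc_posPow hA hr) (continuousOn_rpow hs _)
      (continuousOn_rpow hr _)).congr fun t ht => ?_) (continuousOn_rpow (add_nonneg hs hr) _)
  exact (Real.rpow_add_of_nonneg ht.1 hs hr).symm

theorem posPow_one {A : H →L[ℝ] H} (hA : A.IsPositive) : posPow A 1 = A :=
  (isFunCalc_posPow hA zero_le_one).unique
    ((isFunCalc_id hA).congr fun t _ => (Real.rpow_one t).symm) (continuousOn_rpow zero_le_one _)

theorem norm_posPow_le {A : H →L[ℝ] H} (hA : A.IsPositive) {s : ℝ} (hs : 0 ≤ s) :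
    ‖posPow A s‖ ≤ ‖A‖ ^ s :=
  (isFunCalc_posPow hA hs).norm_le fun t ht => by
    rw [abs_of_nonneg (Real.rpow_nonneg ht.1 s)]
    exact Real.rpow_le_rpow ht.1 ht.2 hs

/-- The tangent at `k` lies above the concave power; this is weighted AM–GM rescaled by `k ^ (r -
1)`. -/
theorem rpow_le_tangent {t k r : ℝ} (ht : 0 ≤ t) (hk : 0 < k) (hr : 0 ≤ r) (hr1 : r ≤ 1) :
    t ^ r ≤ r * k ^ (r - 1) * t + (1 - r) * k ^ r := by
  have h := Real.geom_mean_le_arith_mean2_weighted hr (sub_nonneg.mpr hr1) ht hk.le (by ring)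
  have hp : 0 < k ^ (r - 1) := Real.rpow_pos_of_pos hk _
  have e1 : k ^ (1 - r) * k ^ (r - 1) = 1 := by
    rw [← Real.rpow_add hk]
    simp
  have e2 : k * k ^ (r - 1) = k ^ r := by
    rw [Real.rpow_sub_one hk.ne']
    field_simp
  calc t ^ r = (t ^ r * k ^ (1 - r)) * k ^ (r - 1) := by rw [mul_assoc, e1, mul_one]
    _ ≤ (r * t + (1 - r) * k) * k ^ (r - 1) := by gcongr
    _ = r * k ^ (r - 1) * t + (1 - r) * (k * k ^ (r - 1)) := by ring
    _ = _ := by rw [e2]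

/-- The tangent bound for `t^{2v}` applied to `A`, whence `v ≤ 1/2`. The point `k` stays free: it
becomes `λ` in one use and about `‖Q W‖²` in the other. -/
theorem norm_sq_posPow_apply_le {A : H →L[ℝ] H} (hA : A.IsPositive) {v k : ℝ} (hk : 0 < k)
    (hv : 0 ≤ v) (hv1 : v ≤ 1 / 2) (u : H) :
    ‖posPow A v u‖ ^ 2
      ≤ 2 * v * k ^ (2 * v - 1) * ⟪u, A u⟫ + (1 - 2 * v) * k ^ (2 * v) * ‖u‖ ^ 2 := by
  have h2v : 0 ≤ 2 * v := by linarith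
  have h := (isFunCalc_posPow hA h2v).inner_le hA (continuousOn_rpow h2v _)
    (fun t ht => rpow_le_tangent ht.1 hk h2v (by linarith)) u
  have e : ‖posPow A v u‖ ^ 2 = ⟪u, posPow A (2 * v) u⟫ := by
    rw [two_mul, posPow_add hA hv hv, ← real_inner_self_eq_norm_sq]
    exact (isSelfAdjoint_posPow hA hv).isSymmetric u _
  rw [e]
  exact h

/-! ### Regularized square roots and their inverses. -/

theorem reg_apply (A : H →L[ℝ] H) (lam : ℝ) (u : H) : reg A lam u = A u + lam • u := rfl

theorem isPositive_reg {A : H →L[ℝ] H} (hA : A.IsPositive) {lam : ℝ} (hlam : 0 < lam) :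
    (reg A lam).IsPositive :=
  hA.add (ContinuousLinearMap.isPositive_one.smul_of_nonneg hlam.le)

theorem isSelfAdjoint_regSqrt {A : H →L[ℝ] H} (hA : A.IsPositive) {lam : ℝ} (hlam : 0 < lam) :
    IsSelfAdjoint (regSqrt A lam) :=
  isSelfAdjoint_posPow (isPositive_reg hA hlam) (by norm_num)

theorem regSqrt_mul_self {A : H →L[ℝ] H} (hA : A.IsPositive) {lam : ℝ} (hlam : 0 < lam) :
    regSqrt A lam * regSqrt A lam = reg A lam := by
  rw [regSqrt, ← posPow_add (isPositive_reg hA hlam) (by norm_num) (by norm_num), add_halves,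
    posPow_one (isPositive_reg hA hlam)]

theorem isUnit_reg {A : H →L[ℝ] H} (hA : A.IsPositive) {lam : ℝ} (hlam : 0 < lam) :
    IsUnit (reg A lam) :=
  isUnit_of_forall_mul_sq_norm_le_inner hlam fun u => by
    rw [reg_apply, inner_add_left, inner_smul_left, real_inner_self_eq_norm_sq]
    simpa using hA.inner_nonneg_left u

theorem isUnit_regSqrt {A : H →L[ℝ] H} (hA : A.IsPositive) {lam : ℝ} (hlam : 0 < lam) :
    IsUnit (regSqrt A lam) := by
  have h := isUnit_reg hA hlam
  rw [← regSqrt_mul_self hA hlam] at h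
  exact ((Commute.refl (regSqrt A lam)).isUnit_mul_iff.mp h).1

theorem regInvSqrt_mul_regSqrt {A : H →L[ℝ] H} (hA : A.IsPositive) {lam : ℝ} (hlam : 0 < lam) :
    regInvSqrt A lam * regSqrt A lam = 1 := Ring.inverse_mul_cancel _ (isUnit_regSqrt hA hlam)

theorem regSqrt_mul_regInvSqrt {A : H →L[ℝ] H} (hA : A.IsPositive) {lam : ℝ} (hlam : 0 < lam) :
    regSqrt A lam * regInvSqrt A lam = 1 := Ring.mul_inverse_cancel _ (isUnit_regSqrt hA hlam)

theorem isSelfAdjoint_regInvSqrt {A : H →L[ℝ] H} (hA : A.IsPositive) {lam : ℝ} (hlam : 0 < lam) :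
    IsSelfAdjoint (regInvSqrt A lam) := by
  rw [isSelfAdjoint_iff, regInvSqrt, ← Ring.inverse_star, (isSelfAdjoint_regSqrt hA hlam).star_eq]

theorem norm_sq_regSqrt_apply {A : H →L[ℝ] H} (hA : A.IsPositive) {lam : ℝ} (hlam : 0 < lam)
    (u : H) : ‖regSqrt A lam u‖ ^ 2 = ⟪u, A u⟫ + lam * ‖u‖ ^ 2 := by
  have e : ⟪regSqrt A lam u, regSqrt A lam u⟫ = ⟪u, (regSqrt A lam * regSqrt A lam) u⟫ :=
    (isSelfAdjoint_regSqrt hA hlam).isSymmetric u _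
  rw [← real_inner_self_eq_norm_sq, e, regSqrt_mul_self hA hlam, reg_apply, inner_add_right,
    inner_smul_right, real_inner_self_eq_norm_sq]

end FunctionalCalculus

/-! ### Pseudoinverses and projections -/

theorem IsMoorePenrose.unique {k l : ℕ} {A : Matrix (Fin k) (Fin l) ℝ}
    {B B' : Matrix (Fin l) (Fin k) ℝ} (h : IsMoorePenrose A B) (h' : IsMoorePenrose A B') :
    B = B' := by
  have e1 : A * B = A * B' := by
    calc A * B = (A * B') * (A * B) := by rw [← Matrix.mul_assoc, h'.mul_mul_left]
      _ = ((A * B) * (A * B')).transpose := by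
          rw [Matrix.transpose_mul, h.symm_left, h'.symm_left]
      _ = A * B' := by rw [← Matrix.mul_assoc, h.mul_mul_left, h'.symm_left]
  have e2 : B * A = B' * A := by
    calc B * A = (B * A) * (B' * A) := by
          rw [Matrix.mul_assoc, ← Matrix.mul_assoc A, h'.mul_mul_left]
      _ = ((B' * A) * (B * A)).transpose := by
          rw [Matrix.transpose_mul, h.symm_right, h'.symm_right]
      _ = B' * A := by rw [Matrix.mul_assoc, ← Matrix.mul_assoc A, h.mul_mul_left, h'.symm_right]
  rw [← h.mul_mul_right, e2, Matrix.mul_assoc, e1, ← Matrix.mul_assoc, h'.mul_mul_right]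

theorem exists_isMoorePenrose {k : ℕ} {A : Matrix (Fin k) (Fin k) ℝ} (hA : A.IsHermitian) :
    ∃ B, IsMoorePenrose A B := by
  set φ := Unitary.conjStarAlgAut ℝ (Matrix (Fin k) (Fin k) ℝ) hA.eigenvectorUnitary
  obtain ⟨d, hd⟩ : ∃ d : Fin k → ℝ, A = φ (Matrix.diagonal d) := ⟨_, hA.spectral_theorem⟩
  have hs : ∀ e : Fin k → ℝ, (φ (Matrix.diagonal e)).transpose = φ (Matrix.diagonal e) := by
    intro e
    rw [← Matrix.conjTranspose_eq_transpose_of_trivial, ← Matrix.star_eq_conjTranspose,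
      ← map_star, Matrix.star_eq_conjTranspose, Matrix.diagonal_conjTranspose]
    rfl
  -- The convention `0⁻¹ = 0` keeps the kernel of `A` in the kernel of its pseudoinverse.
  refine ⟨φ (Matrix.diagonal d⁻¹), ?_, ?_, ?_, ?_⟩
  · rw [hd, ← map_mul, ← map_mul, Matrix.diagonal_mul_diagonal, Matrix.diagonal_mul_diagonal]
    congr 3
    ext i
    exact mul_inv_mul_cancel (d i)
  · rw [hd, ← map_mul, ← map_mul, Matrix.diagonal_mul_diagonal, Matrix.diagonal_mul_diagonal]
    congr 3
    ext i
    simpa using mul_inv_mul_cancel (d i)⁻¹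
  · rw [hd, ← map_mul, Matrix.diagonal_mul_diagonal, hs]
  · rw [hd, ← map_mul, Matrix.diagonal_mul_diagonal, hs]

theorem isMoorePenrose_pinv {k : ℕ} {A : Matrix (Fin k) (Fin k) ℝ} (hA : A.IsHermitian) :
    IsMoorePenrose A (pinv A) := by
  rw [pinv, dif_pos (exists_isMoorePenrose hA)]
  exact (exists_isMoorePenrose hA).choose_spec

theorem transpose_pinv {k : ℕ} {A : Matrix (Fin k) (Fin k) ℝ} (hA : A.IsHermitian) :
    (pinv A).transpose = pinv A := by
  have h := isMoorePenrose_pinv hA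
  have hT : A.transpose = A := by
    rw [← Matrix.conjTranspose_eq_transpose_of_trivial]
    exact hA
  refine IsMoorePenrose.unique (A := A) ⟨?_, ?_, ?_, ?_⟩ h
  · have := congrArg Matrix.transpose h.mul_mul_left
    rwa [Matrix.transpose_mul, Matrix.transpose_mul, hT, ← Matrix.mul_assoc] at this
  · have := congrArg Matrix.transpose h.mul_mul_right
    rwa [Matrix.transpose_mul, Matrix.transpose_mul, hT, ← Matrix.mul_assoc] at this
  · have := h.symm_right
    rw [Matrix.transpose_mul, hT] at this
    rw [this, h.symm_right]
  · have := h.symm_left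
    rw [Matrix.transpose_mul, hT] at this
    rw [this, h.symm_left]

section Projection

variable {H : Type*} [NormedAddCommGroup H] [InnerProductSpace ℝ H] [CompleteSpace H]

/-- The operator `D (pinv A) D*`, the orthogonal projection onto the range of `D` if `A = D* D`. -/
def rangeProj {m : ℕ} (D : EuclideanSpace ℝ (Fin m) →L[ℝ] H) (A : Matrix (Fin m) (Fin m) ℝ) :
    H →L[ℝ] H :=
  D ∘L Matrix.toEuclideanCLM (𝕜 := ℝ) (pinv A) ∘L D.adjoint

variable {m : ℕ} {D : EuclideanSpace ℝ (Fin m) →L[ℝ] H} {A : Matrix (Fin m) (Fin m) ℝ}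

theorem isHermitian_of_toEuclideanCLM_eq
    (h : Matrix.toEuclideanCLM (𝕜 := ℝ) A = D.adjoint ∘L D) : A.IsHermitian := by
  have : star (Matrix.toEuclideanCLM (𝕜 := ℝ) A) = Matrix.toEuclideanCLM (𝕜 := ℝ) A := by
    rw [h, ContinuousLinearMap.star_eq_adjoint, ContinuousLinearMap.adjoint_comp,
      ContinuousLinearMap.adjoint_adjoint]
  rw [← map_star] at this
  exact (Matrix.toEuclideanCLM (𝕜 := ℝ)).injective this

/-- By `A A† A = A`, the defect is killed by `D*`; being also in the range of `D`, it is orthogonal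
to itself. -/
theorem rangeProj_comp (h : Matrix.toEuclideanCLM (𝕜 := ℝ) A = D.adjoint ∘L D) :
    rangeProj D A ∘L D = D := by
  have hp := (isMoorePenrose_pinv (isHermitian_of_toEuclideanCLM_eq h)).mul_mul_left
  set B := Matrix.toEuclideanCLM (𝕜 := ℝ) (pinv A) with hB
  have hM : ∀ u, D.adjoint (D (B (D.adjoint (D u)))) = D.adjoint (D u) := fun u => by
    have := congrArg (fun M => Matrix.toEuclideanCLM (𝕜 := ℝ) M u) hp
    simp only [map_mul, h, ← hB] at this
    exact this
  ext u
  rw [← sub_eq_zero, ← inner_self_eq_zero (𝕜 := ℝ)]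
  set w := B (D.adjoint (D u)) - u with hw
  have e : (rangeProj D A ∘L D) u - D u = D w := by
    rw [hw, map_sub]
    rfl
  rw [e, ← ContinuousLinearMap.adjoint_inner_left, hw, map_sub, map_sub, hM, sub_self,
    inner_zero_left]

theorem isStarProjection_rangeProj
    (h : Matrix.toEuclideanCLM (𝕜 := ℝ) A = D.adjoint ∘L D) : IsStarProjection (rangeProj D A) where
  isIdempotentElem := by
    ext u
    exact congrArg (fun T => T (Matrix.toEuclideanCLM (𝕜 := ℝ) (pinv A) (D.adjoint u)))
      (rangeProj_comp h)
  isSelfAdjoint := by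
    have hB : ContinuousLinearMap.adjoint (Matrix.toEuclideanCLM (𝕜 := ℝ) (pinv A))
        = Matrix.toEuclideanCLM (𝕜 := ℝ) (pinv A) := by
      rw [← ContinuousLinearMap.star_eq_adjoint, ← map_star, Matrix.star_eq_conjTranspose,
        Matrix.conjTranspose_eq_transpose_of_trivial,
        transpose_pinv (isHermitian_of_toEuclideanCLM_eq h)]
    rw [isSelfAdjoint_iff, ContinuousLinearMap.star_eq_adjoint, rangeProj,
      ContinuousLinearMap.adjoint_comp, ContinuousLinearMap.adjoint_comp,
      ContinuousLinearMap.adjoint_adjoint, hB]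
    rfl

theorem toEuclideanCLM_gram (z : Fin m → H) :
    Matrix.toEuclideanCLM (𝕜 := ℝ) (gram z) = (anaOp z) ∘L (anaOp z).adjoint := by
  ext u i
  rw [ContinuousLinearMap.comp_apply, anaOp_apply, anaOp_adjoint_apply]
  simp [gram, Matrix.mulVec, dotProduct, inner_sum, inner_smul_right, mul_comm]

end Projection

/-! ### The excess risk -/

section Risk

variable {X : Type*} [MeasurableSpace X] {H : Type*} [NormedAddCommGroup H]
  [InnerProductSpace ℝ H] [CompleteSpace H] [RKHS ℝ H X ℝ]

/-- Kernel sections span a dense subspace and norm convergence implies pointwise convergence. -/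
theorem measurable_of_measurable_ker (h : Measurable fun p : X × X => ker H p.1 p.2) (f : H) :
    Measurable (f : X → ℝ) := by
  have hf : f ∈ (Submodule.span ℝ {RKHS.kerFun H x v | (x : X) (v : ℝ)}).topologicalClosure := by
    rw [RKHS.kerFun_dense]
    trivial
  rw [← SetLike.mem_coe, Submodule.topologicalClosure_coe, mem_closure_iff_seq_limit] at hf
  obtain ⟨g, hg, hlim⟩ := hf
  refine measurable_of_tendsto_metrizable (f := fun k => (g k : X → ℝ)) (fun k => ?_)
    (tendsto_pi_nhds.mpr fun x => ((RKHS.continuous_eval x).tendsto f).comp hlim)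
  have hgk := hg k
  rw [SetLike.mem_coe] at hgk
  generalize g k = f at hgk
  induction hgk using Submodule.span_induction with
  | mem f hf =>
    obtain ⟨x, v, rfl⟩ := hf
    have e : RKHS.kerFun H x v = v • kSec H x := by
      rw [kSec, ← map_smul, smul_eq_mul, mul_one]
    rw [e, RKHS.coe_smul]
    exact (h.comp measurable_prodMk_left).const_smul v
  | zero => rw [RKHS.coe_zero]; exact measurable_zero
  | add f g _ _ hf hg => rw [RKHS.coe_add]; exact hf.add hg
  | smul c f _ hf => rw [RKHS.coe_smul]; exact hf.const_smul c

/-- Pythagoras in L²: the first-order condition at the minimizer removes the cross term. -/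
theorem excess_risk {ρ : Measure (X × ℝ)} [IsProbabilityMeasure ρ] {C : H →L[ℝ] H}
    (hker : Measurable fun p : X × X => ker H p.1 p.2) (hC : IsCovOp ρ.fst C) {fH : H}
    (hfin : risk ρ fH ≠ ⊤) (hmin : ∀ f : H, risk ρ fH ≤ risk ρ f) (f : H) :
    risk ρ f ≠ ⊤ ∧ (risk ρ f).toReal - (risk ρ fH).toReal = ⟪f - fH, C (f - fH)⟫ := by
  have hmeas := measurable_of_measurable_ker hker
  set r : X × ℝ → ℝ := fun p => fH p.1 - p.2 with hr
  have hrm : Measurable r := ((hmeas fH).comp measurable_fst).sub measurable_snd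
  have hr2 : Integrable (fun p => r p ^ 2) ρ := by
    refine ⟨(hrm.pow_const 2).aestronglyMeasurable, ?_⟩
    rw [hasFiniteIntegral_iff_ofReal (Filter.Eventually.of_forall fun p => sq_nonneg _)]
    exact hfin.lt_top
  have hrL : MemLp r 2 ρ := (memLp_two_iff_integrable_sq hrm.aestronglyMeasurable).mpr hr2
  have hhm : ∀ h : H, Measurable fun p : X × ℝ => h p.1 := fun h => (hmeas h).comp measurable_fst
  have hint : ∀ h : H, ∫ p, h p.1 ^ 2 ∂ρ = ⟪h, C h⟫ := fun h => by
    rw [(hC h h).2, Measure.fst, integral_map measurable_fst.aemeasurable]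
    · simp only [sq]
    · exact ((hmeas h).mul (hmeas h)).aestronglyMeasurable
  have hhL : ∀ h : H, MemLp (fun p : X × ℝ => h p.1) 2 ρ := fun h => by
    refine (memLp_two_iff_integrable_sq (hhm h).aestronglyMeasurable).mpr ?_
    have := (hC h h).1.comp_measurable (measurable_fst (α := X) (β := ℝ))
    simpa only [Function.comp_def, ← sq] using this
  have hexp : ∀ h : H, ∫ p, (r p + h p.1) ^ 2 ∂ρ
      = ∫ p, r p ^ 2 ∂ρ + 2 * ∫ p, r p * h p.1 ∂ρ + ⟪h, C h⟫ := fun h => by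
    have h1 : Integrable (fun p => 2 * (r p * h p.1)) ρ := (hrL.integrable_mul (hhL h)).const_mul 2
    have h12 : Integrable (fun p => r p ^ 2 + 2 * (r p * h p.1)) ρ := hr2.add h1
    rw [← hint h, ← integral_const_mul, ← integral_add hr2 h1,
      ← integral_add h12 (hhL h).integrable_sq]
    congr 1
    ext p
    ring
  have hnn : ∀ h : H, 0 ≤ ∫ p, r p ^ 2 ∂ρ + 2 * ∫ p, r p * h p.1 ∂ρ + ⟪h, C h⟫ := fun h => by
    rw [← hexp]
    exact integral_nonneg fun p => sq_nonneg _
  have hrisk : ∀ h : H, risk ρ (fH + h)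
      = ENNReal.ofReal (∫ p, r p ^ 2 ∂ρ + 2 * ∫ p, r p * h p.1 ∂ρ + ⟪h, C h⟫) := fun h => by
    have hi : Integrable (fun p => (r p + h p.1) ^ 2) ρ := (hrL.add (hhL h)).integrable_sq
    rw [← hexp, ofReal_integral_eq_lintegral_ofReal hi
      (Filter.Eventually.of_forall fun p => sq_nonneg _), risk]
    congr 1
    ext p
    rw [RKHS.coe_add, Pi.add_apply, add_sub_right_comm]
  have hrisk0 : risk ρ fH = ENNReal.ofReal (∫ p, r p ^ 2 ∂ρ) := by
    simpa using hrisk 0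
  have horth : ∀ h : H, ∫ p, r p * h p.1 ∂ρ = 0 := fun h => by
    set c := ∫ p, r p * h p.1 ∂ρ with hc
    have hd : 0 ≤ ⟪h, C h⟫ := by
      rw [← hint h]
      exact integral_nonneg fun p => sq_nonneg _
    set d := ⟪h, C h⟫
    have hq : ∀ t : ℝ, 0 ≤ 2 * (t * c) + t ^ 2 * d := fun t => by
      have h1 := hmin (fH + t • h)
      rw [hrisk0, hrisk, ENNReal.ofReal_le_ofReal_iff (hnn _)] at h1
      have e1 : ∫ p, r p * (t • h : H) p.1 ∂ρ = t * c := by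
        rw [hc, ← integral_const_mul]
        congr 1
        ext p
        rw [RKHS.coe_smul, Pi.smul_apply, smul_eq_mul]
        ring
      have e2 : ⟪t • h, C (t • h)⟫ = t ^ 2 * d := by
        rw [map_smul, inner_smul_left, inner_smul_right]
        simp only [conj_trivial]
        ring
      rw [e1, e2] at h1
      linarith
    -- Near-optimal step of the quadratic; the `+ 1` covers `d = 0`.
    have h1 := hq (-c / (d + 1))
    have e : 2 * (-c / (d + 1) * c) + (-c / (d + 1)) ^ 2 * d
        = -(c ^ 2 * (d + 2) / (d + 1) ^ 2) := by
      field_simp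
      ring
    rw [e] at h1
    by_contra hne
    have : 0 < c ^ 2 * (d + 2) / (d + 1) ^ 2 := by positivity
    linarith
  have hf := hrisk (f - fH)
  have hn := hnn (f - fH)
  rw [horth, add_sub_cancel] at hf
  rw [horth] at hn
  refine ⟨by rw [hf]; exact ENNReal.ofReal_ne_top, ?_⟩
  rw [hf, hrisk0, ENNReal.toReal_ofReal hn,
    ENNReal.toReal_ofReal (integral_nonneg fun p => sq_nonneg _)]
  ring

end Risk

/-! ### Operator estimates -/

section Estimates

variable {H : Type*} [NormedAddCommGroup H] [InnerProductSpace ℝ H] [CompleteSpace H]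

theorem norm_mul_comm_of_isSelfAdjoint {S T : H →L[ℝ] H} (hS : IsSelfAdjoint S)
    (hT : IsSelfAdjoint T) : ‖S * T‖ = ‖T * S‖ := by
  rw [← norm_star (S * T), star_mul, hS.star_eq, hT.star_eq]

theorem norm_le_of_sq_le {T : H →L[ℝ] H} {c : ℝ} (hc : 0 ≤ c)
    (h : ∀ u, ‖T u‖ ^ 2 ≤ c ^ 2 * ‖u‖ ^ 2) : ‖T‖ ≤ c :=
  T.opNorm_le_bound hc fun u =>
    le_of_sq_le_sq (by rw [mul_pow]; exact h u) (mul_nonneg hc (norm_nonneg u))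

/-- With `k = λ` the tangent bound is at most `λ^{2v-1} (⟪u, C u⟫ + λ‖u‖²)`, and the bracket is `‖(C
+ λ)^{1/2} u‖²`. -/
theorem norm_regInvSqrt_mul_posPow_le {C : H →L[ℝ] H} (hC : C.IsPositive) {lam : ℝ}
    (hlam : 0 < lam) {v : ℝ} (hv : 0 ≤ v) (hv1 : v ≤ 1 / 2) :
    ‖regInvSqrt C lam * posPow C v‖ ≤ lam ^ (v - 1 / 2) := by
  rw [norm_mul_comm_of_isSelfAdjoint (isSelfAdjoint_regInvSqrt hC hlam)
    (isSelfAdjoint_posPow hC hv)]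
  refine norm_le_of_sq_le (Real.rpow_nonneg hlam.le _) fun w => ?_
  set u := regInvSqrt C lam w with hu
  have hw : regSqrt C lam u = w := by
    rw [hu, ← mul_apply_eq_comp, regSqrt_mul_regInvSqrt hC hlam, one_apply_eq_self]
  have h1 := norm_sq_posPow_apply_le hC hlam hv hv1 u
  have h2 := norm_sq_regSqrt_apply hC hlam u
  have h3 : 0 ≤ ⟪u, C u⟫ := hC.inner_nonneg_right u
  have e : (lam ^ (v - 1 / 2)) ^ 2 = lam ^ (2 * v - 1) := by
    rw [← Real.rpow_natCast, ← Real.rpow_mul hlam.le]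
    congr 1
    push_cast
    ring
  have e' : lam ^ (2 * v) = lam ^ (2 * v - 1) * lam := by
    rw [Real.rpow_sub_one hlam.ne']
    field_simp
  have hp : 0 ≤ lam ^ (2 * v - 1) := Real.rpow_nonneg hlam.le _
  rw [mul_apply_eq_comp, ← hu, ← hw, e, h2]
  rw [e'] at h1
  have h4 : 2 * v * (lam ^ (2 * v - 1) * ⟪u, C u⟫) ≤ lam ^ (2 * v - 1) * ⟪u, C u⟫ :=
    mul_le_of_le_one_left (mul_nonneg hp h3) (by linarith)
  have h5 : (1 - 2 * v) * (lam ^ (2 * v - 1) * lam * ‖u‖ ^ 2) ≤ lam ^ (2 * v - 1) * lam * ‖u‖ ^ 2 :=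
    mul_le_of_le_one_left (by positivity) (by linarith)
  linarith

/-- Interpolation between `‖Q‖ ≤ 1` at `v = 0` and `‖Q C^{1/2}‖ ≤ ‖Q W‖` at `v = 1/2`. -/
theorem norm_mul_posPow_le {C : H →L[ℝ] H} (hC : C.IsPositive) {lam : ℝ}
    (hlam : 0 < lam) {v : ℝ} (hv : 0 ≤ v) (hv1 : v ≤ 1 / 2) {Q : H →L[ℝ] H}
    (hQ : IsSelfAdjoint Q) (hQ1 : ‖Q‖ ≤ 1) :
    ‖Q * posPow C v‖ ≤ (‖Q * regSqrt C lam‖ ^ 2) ^ v := by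
  -- A strictly larger `k` is positive even if `Q W = 0`; it then decreases to `‖Q W‖²`.
  have key : ∀ k, ‖Q * regSqrt C lam‖ ^ 2 < k → ‖Q * posPow C v‖ ≤ k ^ v := by
    intro k hk
    have hk0 : 0 < k := (sq_nonneg _).trans_lt hk
    rw [norm_mul_comm_of_isSelfAdjoint hQ (isSelfAdjoint_posPow hC hv)]
    rw [norm_mul_comm_of_isSelfAdjoint hQ (isSelfAdjoint_regSqrt hC hlam)] at hk
    refine norm_le_of_sq_le (Real.rpow_nonneg hk0.le _) fun w => ?_
    have h1 := norm_sq_posPow_apply_le hC hk0 hv hv1 (Q w)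
    have h2 : ⟪Q w, C (Q w)⟫ ≤ k * ‖w‖ ^ 2 := by
      calc ⟪Q w, C (Q w)⟫ ≤ ‖regSqrt C lam (Q w)‖ ^ 2 := by
            rw [norm_sq_regSqrt_apply hC hlam]
            linarith [mul_nonneg hlam.le (sq_nonneg ‖Q w‖)]
        _ ≤ (‖regSqrt C lam * Q‖ * ‖w‖) ^ 2 := by
            gcongr
            exact (regSqrt C lam * Q).le_opNorm w
        _ = ‖regSqrt C lam * Q‖ ^ 2 * ‖w‖ ^ 2 := mul_pow _ _ _
        _ ≤ k * ‖w‖ ^ 2 := by gcongr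
    have h3 : ‖Q w‖ ^ 2 ≤ ‖w‖ ^ 2 := by
      gcongr
      simpa using Q.le_of_opNorm_le hQ1 w
    have e : (k ^ v) ^ 2 = k ^ (2 * v) := by
      rw [← Real.rpow_natCast, ← Real.rpow_mul hk0.le, mul_comm]
      norm_cast
    have e' : k ^ (2 * v) = k ^ (2 * v - 1) * k := by
      rw [Real.rpow_sub_one hk0.ne']
      field_simp
    have hp : 0 ≤ k ^ (2 * v - 1) := Real.rpow_nonneg hk0.le _
    have hp' : 0 ≤ k ^ (2 * v) := Real.rpow_nonneg hk0.le _
    rw [mul_apply_eq_comp, e]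
    calc _ ≤ _ := h1
      _ ≤ 2 * v * k ^ (2 * v - 1) * (k * ‖w‖ ^ 2) + (1 - 2 * v) * k ^ (2 * v) * ‖w‖ ^ 2 := by
          have : 0 ≤ 1 - 2 * v := by linarith
          gcongr
      _ = _ := by rw [e']; ring
  have hlim : Filter.Tendsto (fun k : ℝ => k ^ v)
      (nhdsWithin (‖Q * regSqrt C lam‖ ^ 2) (Set.Ioi (‖Q * regSqrt C lam‖ ^ 2)))
      (nhds ((‖Q * regSqrt C lam‖ ^ 2) ^ v)) :=
    ((Real.continuous_rpow_const hv).tendsto _).mono_left nhdsWithin_le_nhds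
  exact ge_of_tendsto hlim (Filter.eventually_of_mem self_mem_nhdsWithin fun k hk => key k hk)

/-- The deterministic error decomposition, for an estimator `G w` of `C ^ v h`. -/
theorem norm_regSqrt_apply_sub_le {C C' : H →L[ℝ] H} (hC : C.IsPositive) (hC' : C'.IsPositive)
    {lam : ℝ} (hlam : 0 < lam) {v : ℝ} (hv : 0 ≤ v) (hv1 : v ≤ 1 / 2) {G P : H →L[ℝ] H}
    (hG : IsStarProjection (regSqrt C' lam * G * regSqrt C' lam)) (hP : IsStarProjection P)
    (hGP : G * reg C' lam * P = P) (w h : H) :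
    ‖regSqrt C lam (G w - posPow C v h)‖
      ≤ ‖regInvSqrt C' lam * regSqrt C lam‖ ^ 2
          * ‖regInvSqrt C lam (w - C' (posPow C v h))‖
        + (1 + ‖regSqrt C' lam * regInvSqrt C lam‖ * ‖regInvSqrt C' lam * regSqrt C lam‖)
          * ((‖(1 - P) * regSqrt C lam‖ ^ 2) ^ (1 / 2 + v) * ‖h‖)
        + ‖regInvSqrt C' lam * regSqrt C lam‖ ^ 2 * (lam ^ (1 / 2 + v) * ‖h‖) := by
  set W := regSqrt C lam with hW
  set Wi := regInvSqrt C lam with hWi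
  set V := regSqrt C' lam with hV
  set Vi := regInvSqrt C' lam with hVi
  set T := posPow C v with hT
  set β := ‖Vi * W‖ with hβ
  set θ := ‖V * Wi‖ with hθ
  set Q := 1 - P with hQ
  have hWsa : IsSelfAdjoint W := isSelfAdjoint_regSqrt hC hlam
  have hVisa : IsSelfAdjoint Vi := isSelfAdjoint_regInvSqrt hC' hlam
  have hWWi : W * Wi = 1 := regSqrt_mul_regInvSqrt hC hlam
  have hWiW : Wi * W = 1 := regInvSqrt_mul_regSqrt hC hlam
  have hVVi : V * Vi = 1 := regSqrt_mul_regInvSqrt hC' hlam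
  have hViV : Vi * V = 1 := regInvSqrt_mul_regSqrt hC' hlam
  have hQp : IsStarProjection Q := hP.one_sub
  have hQQ : Q * Q = Q := hQp.isIdempotentElem
  have hVV : V * V = reg C' lam := regSqrt_mul_self hC' hlam
  have hWVi : ‖W * Vi‖ = β := norm_mul_comm_of_isSelfAdjoint hWsa hVisa
  have hβ0 : 0 ≤ β := norm_nonneg _
  have hWViF : ‖W * Vi * (V * G * V)‖ ≤ β := by
    refine (norm_mul_le _ _).trans ?_
    rw [hWVi]
    exact mul_le_of_le_one_right hβ0 hG.norm_le
  have hWGW : ‖W * G * W‖ ≤ β ^ 2 := by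
    have e : W * G * W = W * Vi * (V * G * V) * (Vi * W) := by
      calc W * G * W = W * 1 * G * 1 * W := by simp only [mul_one]
        _ = W * (Vi * V) * G * (V * Vi) * W := by rw [hViV, hVVi]
        _ = _ := by simp only [mul_assoc]
    rw [e, sq]
    exact (norm_mul_le _ _).trans (mul_le_mul_of_nonneg_right hWViF hβ0)
  have hWG : ∀ u, ‖W (G u)‖ ≤ β ^ 2 * ‖Wi u‖ := fun u => by
    have e : W (G u) = (W * G * W) (Wi u) := by
      calc W (G u) = (W * G * (W * Wi)) u := by rw [hWWi, mul_one]; rfl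
        _ = _ := rfl
    rw [e]
    exact ContinuousLinearMap.le_of_opNorm_le _ hWGW _
  -- Inserting `V⁻¹ V` and `W⁻¹ W` exposes the projection and a right factor `W Q` in both terms.
  have hbias : W * (1 - G * reg C' lam) * Q = W * Q - W * Vi * (V * G * V) * (V * Wi) * (W * Q) := by
    have e : W * Vi * (V * G * V) * (V * Wi) * (W * Q) = W * G * (V * V) * Q := by
      calc W * Vi * (V * G * V) * (V * Wi) * (W * Q)
          = W * (Vi * V) * G * (V * V) * (Wi * W) * Q := by simp only [mul_assoc]
        _ = _ := by rw [hViV, hWiW, mul_one, mul_one]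
    rw [e, hVV]
    noncomm_ring
  set c := ‖Q * W‖ with hc
  have hc0 : 0 ≤ c := norm_nonneg _
  have hWQ : ‖W * Q‖ = c := norm_mul_comm_of_isSelfAdjoint hWsa hQp.isSelfAdjoint
  have hbias_le : ‖W * (1 - G * reg C' lam) * Q‖ ≤ (1 + θ * β) * c := by
    rw [hbias]
    calc _ ≤ ‖W * Q‖ + ‖W * Vi * (V * G * V) * (V * Wi) * (W * Q)‖ := norm_sub_le _ _
      _ ≤ ‖W * Q‖ + ‖W * Vi * (V * G * V)‖ * ‖V * Wi‖ * ‖W * Q‖ := by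
          gcongr
          refine (norm_mul_le _ _).trans ?_
          gcongr
          exact norm_mul_le _ _
      _ ≤ c + β * θ * c := by
          rw [hWQ]
          gcongr
      _ = _ := by ring
  have hzero : (1 - G * reg C' lam) = (1 - G * reg C' lam) * Q := by
    rw [hQ, mul_sub, mul_one, sub_mul 1 _ P, hGP, one_mul, sub_self, sub_zero]
  have hsplit : G w - T h = G (w - C' (T h)) - (1 - G * reg C' lam) (T h) - lam • G (T h) := by
    have e : (1 - G * reg C' lam) (T h) = T h - (G (C' (T h)) + lam • G (T h)) := by
      rw [sub_apply, one_apply_eq_self, mul_apply_eq_comp, reg_apply, map_add, map_smul]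
    rw [e, map_sub]
    abel
  have hterm : ‖W ((1 - G * reg C' lam) (T h))‖ ≤ (1 + θ * β) * ((c ^ 2) ^ (1 / 2 + v) * ‖h‖) := by
    -- `Q = Q²` is used twice over: one copy contributes `c`, the other `c^{2v}` through `C^v`.
    have e : W ((1 - G * reg C' lam) (T h)) = (W * (1 - G * reg C' lam) * Q) ((Q * T) h) := by
      calc W ((1 - G * reg C' lam) (T h)) = (W * ((1 - G * reg C' lam) * (Q * Q)) * T) h := by
            rw [hQQ, ← hzero]; rfl
        _ = _ := by simp only [mul_assoc]; rfl
    have hQT : ‖Q * T‖ ≤ (c ^ 2) ^ v :=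
      norm_mul_posPow_le hC hlam hv hv1 hQp.isSelfAdjoint hQp.norm_le
    have e' : (c ^ 2) ^ (1 / 2 + v) = c * (c ^ 2) ^ v := by
      rw [Real.rpow_add_of_nonneg (sq_nonneg c) (by norm_num) hv, ← Real.sqrt_eq_rpow,
        Real.sqrt_sq hc0]
    rw [e, e']
    calc _ ≤ ‖W * (1 - G * reg C' lam) * Q‖ * ‖(Q * T) h‖ := ContinuousLinearMap.le_opNorm _ _
      _ ≤ (1 + θ * β) * c * ((c ^ 2) ^ v * ‖h‖) := by
          gcongr
          exact ContinuousLinearMap.le_of_opNorm_le _ hQT h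
      _ = _ := by ring
  have hreg : ‖W (lam • G (T h))‖ ≤ β ^ 2 * (lam ^ (1 / 2 + v) * ‖h‖) := by
    have e' : lam ^ (1 / 2 + v) = lam * lam ^ (v - 1 / 2) := by
      rw [← Real.rpow_one_add' hlam.le (by intro h0; linarith)]
      congr 1
      ring
    rw [map_smul, norm_smul, Real.norm_eq_abs, abs_of_pos hlam, e']
    calc lam * ‖W (G (T h))‖ ≤ lam * (β ^ 2 * ‖(Wi * T) h‖) := by
          gcongr
          exact hWG _
      _ ≤ lam * (β ^ 2 * (lam ^ (v - 1 / 2) * ‖h‖)) := by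
          gcongr
          exact ContinuousLinearMap.le_of_opNorm_le _
            (norm_regInvSqrt_mul_posPow_le hC hlam hv hv1) h
      _ = _ := by ring
  rw [hsplit, map_sub, map_sub]
  exact (norm_sub_le _ _).trans
    (add_le_add ((norm_sub_le _ _).trans (add_le_add (hWG _) hterm)) hreg)

end Estimates

/-! ### The generalized Nyström estimator -/

section Nystrom

variable {X : Type*} {H : Type*} [NormedAddCommGroup H] [InnerProductSpace ℝ H] [CompleteSpace H]
  [RKHS ℝ H X ℝ]

theorem isPositive_empCov {n : ℕ} (x : Fin n → X) : (empCov H x).IsPositive := by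
  refine (ContinuousLinearMap.isPositive_iff _).mpr ⟨fun f g => ?_, fun f => ?_⟩
  · have e : ⟪empCov H x f, g⟫ = ⟪f, empCov H x g⟫ := by
      rw [real_inner_comm, inner_empCov, inner_empCov]
      simp only [mul_comm]
    exact e
  · rw [real_inner_comm, inner_empCov]
    exact mul_nonneg (by positivity) (Finset.sum_nonneg fun i _ => mul_self_nonneg _)

theorem IsCovOp.isPositive [MeasurableSpace X] {μ : Measure X} {C : H →L[ℝ] H}
    (h : IsCovOp μ C) : C.IsPositive := by
  refine (ContinuousLinearMap.isPositive_iff _).mpr ⟨fun f g => ?_, fun f => ?_⟩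
  · have e : ⟪C f, g⟫ = ⟪f, C g⟫ := by
      rw [real_inner_comm, (h g f).2, (h f g).2]
      simp only [mul_comm]
    exact e
  · rw [real_inner_comm, (h f f).2]
    exact integral_nonneg fun x => mul_self_nonneg _

variable (H) in
theorem adjoint_sampOp_yHat {n : ℕ} (x : Fin n → X) (y : Fin n → ℝ) :
    (sampOp H x).adjoint (yHat y) = (n : ℝ)⁻¹ • ∑ i, y i • kSec H (x i) := by
  rw [sampOp, yHat, map_smul, map_smulₛₗ, smul_apply, anaOp_adjoint_apply, smul_smul]
  simp [← mul_inv]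

/-- The operator that maps `S_n^* ŷ` to the generalized Nyström estimator. -/
def nysOp {n m : ℕ} (x : Fin n → X) (z : Fin m → H) (lam : ℝ) : H →L[ℝ] H :=
  (n : ℝ) • ((anaOp z).adjoint ∘L Matrix.toEuclideanCLM (𝕜 := ℝ)
    (pinv ((evalMat x z).transpose * evalMat x z + (lam * n) • gram z)) ∘L anaOp z)

theorem nysEstimator_eq {n m : ℕ} (hn : 0 < n) (x : Fin n → X) (y : Fin n → ℝ) (z : Fin m → H)
    (lam : ℝ) : nysEstimator x y z lam = nysOp x z lam ((sampOp H x).adjoint (yHat y)) := by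
  have hn' : (n : ℝ) ≠ 0 := by positivity
  have e : anaOp z (∑ i, y i • kSec H (x i))
      = WithLp.toLp 2 ((evalMat x z).transpose.mulVec y) := by
    ext j
    rw [anaOp_apply]
    simp [inner_sum, inner_smul_right, inner_kSec, evalMat, Matrix.mulVec, dotProduct, mul_comm]
  rw [adjoint_sampOp_yHat, nysOp, smul_apply, map_smul, smul_smul, mul_inv_cancel₀ hn', one_smul,
    ContinuousLinearMap.comp_apply, ContinuousLinearMap.comp_apply, e, anaOp_adjoint_apply]
  rfl

/-- `B u` samples `Z_m^* u`, so `BᵀB = n Z_m C_n Z_m^*`; the factor `n` in `λ n G` matches this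
scaling. -/
theorem toEuclideanCLM_normalMatrix {n m : ℕ} (hn : 0 < n) (x : Fin n → X) (z : Fin m → H)
    (lam : ℝ) :
    Matrix.toEuclideanCLM (𝕜 := ℝ) ((evalMat x z).transpose * evalMat x z + (lam * n) • gram z)
      = (n : ℝ) • (anaOp z ∘L reg (empCov H x) lam ∘L (anaOp z).adjoint) := by
  have hn' : (n : ℝ) ≠ 0 := by positivity
  ext u j
  have e1 : ∀ i, ((anaOp z).adjoint u : H) (x i) = (evalMat x z).mulVec u i := fun i => by
    rw [← inner_kSec, anaOp_adjoint_apply, sum_inner]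
    simp [inner_smul_left, inner_kSec, evalMat, Matrix.mulVec, dotProduct, mul_comm]
  have e2 : ⟪z j, (anaOp z).adjoint u⟫ = (gram z).mulVec u j := by
    rw [anaOp_adjoint_apply]
    simp [gram, Matrix.mulVec, dotProduct, inner_sum, inner_smul_right, mul_comm]
  have e3 : ((n : ℝ) • (anaOp z ∘L reg (empCov H x) lam ∘L (anaOp z).adjoint)) u j
      = n * ⟪z j, reg (empCov H x) lam ((anaOp z).adjoint u)⟫ := rfl
  rw [e3, reg_apply, inner_add_right, inner_smul_right, inner_empCov, e2]
  simp_rw [e1]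
  have e4 : (Matrix.toEuclideanCLM (𝕜 := ℝ)
      ((evalMat x z).transpose * evalMat x z + (lam * n) • gram z)) u j
      = ((evalMat x z).transpose * evalMat x z + (lam * n) • gram z).mulVec u j := rfl
  rw [e4, Matrix.add_mulVec, Matrix.smul_mulVec, ← Matrix.mulVec_mulVec, mul_add,
    mul_inv_cancel_left₀ hn']
  simp only [Pi.add_apply, Pi.smul_apply, smul_eq_mul]
  congr 1
  ring

/-! ### The estimator as an orthogonal projection. -/

variable {n m : ℕ} (x : Fin n → X) (z : Fin m → H) {lam : ℝ}

/-- `√n (C_n + λ I)^{1/2} Z_m^*`. -/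
def nysFactor (lam : ℝ) : EuclideanSpace ℝ (Fin m) →L[ℝ] H :=
  Real.sqrt n • (regSqrt (empCov H x) lam ∘L (anaOp z).adjoint)

theorem toEuclideanCLM_eq_nysFactor (hn : 0 < n) (hlam : 0 < lam) :
    Matrix.toEuclideanCLM (𝕜 := ℝ) ((evalMat x z).transpose * evalMat x z + (lam * n) • gram z)
      = (nysFactor x z lam).adjoint ∘L nysFactor x z lam := by
  have hsa := (isSelfAdjoint_regSqrt (isPositive_empCov (H := H) x) hlam).adjoint_eq
  rw [toEuclideanCLM_normalMatrix hn, nysFactor, map_smulₛₗ, ContinuousLinearMap.adjoint_comp,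
    ContinuousLinearMap.adjoint_adjoint, hsa, ← regSqrt_mul_self (isPositive_empCov x) hlam]
  ext u j
  simp [ContinuousLinearMap.comp_apply, ← mul_assoc]

theorem regSqrt_mul_nysOp_mul_regSqrt (hlam : 0 < lam) :
    regSqrt (empCov H x) lam * nysOp x z lam * regSqrt (empCov H x) lam
      = rangeProj (nysFactor x z lam)
        ((evalMat x z).transpose * evalMat x z + (lam * n) • gram z) := by
  have hsa := (isSelfAdjoint_regSqrt (isPositive_empCov (H := H) x) hlam).adjoint_eq
  rw [rangeProj, nysFactor, map_smulₛₗ, ContinuousLinearMap.adjoint_comp,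
    ContinuousLinearMap.adjoint_adjoint, hsa]
  ext u
  simp [nysOp, mul_apply_eq_comp, smul_smul]

theorem isStarProjection_regSqrt_mul_nysOp_mul_regSqrt (hn : 0 < n) (hlam : 0 < lam) :
    IsStarProjection (regSqrt (empCov H x) lam * nysOp x z lam * regSqrt (empCov H x) lam) := by
  rw [regSqrt_mul_nysOp_mul_regSqrt x z hlam]
  exact isStarProjection_rangeProj (toEuclideanCLM_eq_nysFactor x z hn hlam)

theorem isStarProjection_nysProj : IsStarProjection (nysProj z) := by
  have h := isStarProjection_rangeProj (D := (anaOp z).adjoint) (A := gram z) (by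
    rw [ContinuousLinearMap.adjoint_adjoint]
    exact toEuclideanCLM_gram z)
  rwa [rangeProj, ContinuousLinearMap.adjoint_adjoint] at h

/-- The projection `V G V` fixes the range of `V Z_m^*`, the range of `P_m` lies in that of `Z_m^*`,
and the injective `V` cancels on the left. -/
theorem nysOp_mul_reg_mul_nysProj (hn : 0 < n) (hlam : 0 < lam) :
    nysOp x z lam * reg (empCov H x) lam * nysProj z = nysProj z := by
  have hpos := isPositive_empCov (H := H) x
  set V := regSqrt (empCov H x) lam with hV
  have hs : Real.sqrt n ≠ 0 := by positivity
  have h1 : ∀ a, V (nysOp x z lam (V (V ((anaOp z).adjoint a)))) = V ((anaOp z).adjoint a) := by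
    intro a
    have h2 := rangeProj_comp (toEuclideanCLM_eq_nysFactor x z hn hlam)
    rw [← regSqrt_mul_nysOp_mul_regSqrt x z hlam, ← hV] at h2
    have h3 : (V * nysOp x z lam * V) (Real.sqrt n • V ((anaOp z).adjoint a))
        = Real.sqrt n • V ((anaOp z).adjoint a) := congrArg (fun T => T a) h2
    rw [map_smul] at h3
    exact smul_right_injective H hs h3
  have hinj : Function.Injective V := fun a b hab => by
    have h4 := congrArg (regInvSqrt (empCov H x) lam) hab
    rwa [← mul_apply_eq_comp, ← mul_apply_eq_comp, regInvSqrt_mul_regSqrt hpos hlam] at h4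
  rw [← regSqrt_mul_self hpos hlam, ← hV]
  exact ContinuousLinearMap.ext fun u => hinj (h1 _)

end Nystrom

end KRLS

end

/-! ### The error decomposition for the risk. -/

theorem mainTheorem3
    {X : Type*} [MeasurableSpace X]
    {H : Type*} [NormedAddCommGroup H] [InnerProductSpace ℝ H] [CompleteSpace H]
    [TopologicalSpace.SeparableSpace H] [RKHS ℝ H X ℝ]
    (ρ : Measure (X × ℝ)) [IsProbabilityMeasure ρ]
    (fH : H) (hfin : KRLS.risk ρ fH ≠ ⊤) (hmin : ∀ f : H, KRLS.risk ρ fH ≤ KRLS.risk ρ f)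
    (Q γ : ℝ) (hcap : KRLS.CapacityAssumption H ρ.fst Q γ)
    (s R : ℝ) (hs : 0 ≤ s) (hR : 1 ≤ R) (hsrc : KRLS.SourceAssumption ρ.fst fH s R)
    (v : ℝ) (hv : v = min s (1 / 2))
    (n m : ℕ) (hn : 0 < n) (hm : 0 < m)
    (x : Fin n → X) (y : Fin n → ℝ) (z : Fin m → H)
    (lam : ℝ) (hlam : 0 < lam)
    (q : ℝ)
    (hq : q = R * max 1 (‖KRLS.covOp H ρ.fst‖ ^ (s - v)) *
      max (KRLS.betaConst H ρ.fst x lam ^ 2)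
        (1 + KRLS.thetaConst H ρ.fst x lam * KRLS.betaConst H ρ.fst x lam)) :
    KRLS.risk ρ (KRLS.nysEstimator x y z lam) ≠ ⊤ ∧
    Real.sqrt |(KRLS.risk ρ (KRLS.nysEstimator x y z lam)).toReal - (KRLS.risk ρ fH).toReal| ≤
      q * (KRLS.sampleErr ρ.fst fH x y lam + KRLS.compErr ρ.fst z lam ^ (1 / 2 + v)
        + lam ^ (1 / 2 + v)) := by
  have hC : KRLS.IsCovOp ρ.fst (KRLS.covOp H ρ.fst) := KRLS.isCovOp_covOp hcap.bounded_cov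
  have hCpos := hC.isPositive
  have hC'pos := KRLS.isPositive_empCov (H := H) x
  obtain ⟨hne, hdiff⟩ := KRLS.excess_risk hcap.measurable_ker hC hfin hmin
    (KRLS.nysEstimator x y z lam)
  refine ⟨hne, ?_⟩
  obtain ⟨g, hg, hgR⟩ := hsrc
  have hv0 : 0 ≤ v := by rw [hv]; exact le_min hs (by norm_num)
  have hv1 : v ≤ 1 / 2 := by rw [hv]; exact min_le_right _ _
  have hvs : 0 ≤ s - v := by rw [hv]; exact sub_nonneg.mpr (min_le_left _ _)
  set C := KRLS.covOp H ρ.fst with hCdef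
  -- Interpolation reaches only exponent `v ≤ 1/2`; the surplus smoothness `C^{s-v}` is absorbed
  -- into the source element at cost `‖C‖^{s-v}`.
  set h := KRLS.posPow C (s - v) g with hh
  have hfH : fH = KRLS.posPow C v h := by
    rw [← hg, hh, ← mul_apply_eq_comp, ← KRLS.posPow_add hCpos hv0 hvs, add_sub_cancel]
  set M := max 1 (‖C‖ ^ (s - v)) with hM
  have hM1 : 1 ≤ M := le_max_left _ _
  have hhR : ‖h‖ ≤ R * M := by
    calc ‖h‖ ≤ ‖C‖ ^ (s - v) * ‖g‖ :=
          ContinuousLinearMap.le_of_opNorm_le _ (KRLS.norm_posPow_le hCpos hvs) g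
      _ ≤ M * R := by
          gcongr
          exact le_max_right _ _
      _ = R * M := mul_comm _ _
  -- The sample term carries no factor `‖h‖`, so a common constant needs `R M ≥ 1`.
  have hRM : 1 ≤ R * M := one_le_mul_of_one_le_of_one_le hR hM1
  have hmain := KRLS.norm_regSqrt_apply_sub_le hCpos hC'pos hlam hv0 hv1
    (KRLS.isStarProjection_regSqrt_mul_nysOp_mul_regSqrt x z hn hlam)
    (KRLS.isStarProjection_nysProj z) (KRLS.nysOp_mul_reg_mul_nysProj x z hn hlam)
    ((KRLS.sampOp H x).adjoint (KRLS.yHat y)) h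
  rw [← hfH, ← KRLS.nysEstimator_eq hn] at hmain
  set S := KRLS.sampleErr ρ.fst fH x y lam with hS
  set κ := KRLS.compErr ρ.fst z lam ^ (1 / 2 + v) with hκ
  set β := KRLS.betaConst H ρ.fst x lam with hβ
  set θ := KRLS.thetaConst H ρ.fst x lam with hθ
  set N := max (β ^ 2) (1 + θ * β) with hN
  change _ ≤ β ^ 2 * S + (1 + θ * β) * (κ * ‖h‖) + β ^ 2 * (lam ^ (1 / 2 + v) * ‖h‖) at hmain
  have hS0 : 0 ≤ S := norm_nonneg _
  have hκ0 : 0 ≤ κ := Real.rpow_nonneg (sq_nonneg _) _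
  have hl0 : 0 ≤ lam ^ (1 / 2 + v) := Real.rpow_nonneg hlam.le _
  have hN1 : β ^ 2 ≤ N := le_max_left _ _
  have hN2 : 1 + θ * β ≤ N := le_max_right _ _
  have hN0 : 0 ≤ N := (sq_nonneg β).trans hN1
  set d := KRLS.nysEstimator x y z lam - fH with hd
  have hdC : 0 ≤ ⟪d, C d⟫ := hCpos.inner_nonneg_right d
  rw [hdiff, abs_of_nonneg hdC]
  calc Real.sqrt ⟪d, C d⟫ ≤ ‖KRLS.regSqrt C lam d‖ := by
        refine Real.sqrt_le_iff.mpr ⟨norm_nonneg _, ?_⟩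
        rw [KRLS.norm_sq_regSqrt_apply hCpos hlam]
        linarith [mul_nonneg hlam.le (sq_nonneg ‖d‖)]
    _ ≤ _ := hmain
    _ ≤ N * ((R * M) * S) + N * (κ * (R * M)) + N * (lam ^ (1 / 2 + v) * (R * M)) := by
        gcongr
        exact le_mul_of_one_le_left hS0 hRM
    _ = q * (S + κ + lam ^ (1 / 2 + v)) := by
        rw [hq]
        ring
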